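/- Let $d\ge 1$ and $\alpha\ge d+1$ be integers, and let $X=C[0,1]$ with the sup norm. Let $k:[0,1]\times[0,1]\times\mathbb R\to\mathbb R$ and $f:[0,1]\to\mathbb R$ be continuous, and let $K(x)(s)=\int_0^1 k(s,t,x(t))\,dt$ for $x\in X$. Assume that the Urysohn equation $x-K(x)=f$ has a unique solution $\varphi\in X$, that $a<\varphi(s)<b$ for all $s\in[0,1]$, and, with $\Omega=[0,1]\times[0,1]\times[a,b]$, that $k\in C^{\alpha}(\Omega)$, $\partial k/\partial u\in C^{2\alpha}(\Omega)$ and $f\in C^\alpha[0,1]$. Assume that $1$ is not an eigenvalue of the Fréchet derivative $K'(\varphi)$. For $n\ge 1$ let $h=1/n$, $t_i=ih$ for $0\le i\le n$, $t_i=0$ for $i<0$ and $t_i=1$ for $i>n$. Let $S_n$ be the space of functions of class $C^{d-1}$ on $[0,1]$ that are polynomials of degree at most $d$ on each $[t_{i-1},t_i]$, $1\le i\le n$; let $B_1,\dots,B_{n+d}$ be its (normalized) B-splines of degree $d$, $B_i$ having support $[t_{i-d-1},t_i]$; and let $\xi_j=j/(2n)$, $0\le j\le 2n$. Fix an integer $r\ge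 0$ and let $(\pi_n)$ be a sequence of bounded linear operators on $X$, with norms bounded uniformly in $n$ for all large $n$, such that for all large $n$ the operator $\pi_n$ is a spline quasi-interpolating projector: $\pi_n x=\sum_{i=1}^{n+d}\lambda_i(x)B_i$ with $\lambda_i(x)=\sum_j\sigma_{i,j}\,x(\xi_j)$, where only nodes $\xi_j\in[t_{i-d-1}-rh,\;t_i+rh]$ are used in $\lambda_i$, and $\pi_n x=x$ for all $x\in S_n$. (For $r=0$ only nodes in the support of $B_i$ are used.) Let $K_n^H(x)=\pi_nK(x)+K(\pi_nx)-\pi_nK(\pi_nx)$. Then there is $\delta>0$ such that for all large $n$ the equation $x-K_n^H(x)=f$ has a unique solution $\varphi_n^H$ in the ball $\{x\in X:\|x-\varphi\|_\infty<\delta\}$, and as $n\to\infty$: (i) if $d$ is odd, then $\|\varphi_n^H-\varphi\|_\infty=O(h^{2d+2})$; (ii) if $d$ is even, $\varphi^{(d+2)}$ is bounded (in the sense that $\varphi^{(d+1)}$ is Lipschitz on $[0,1]$), and for all large $n$ the coefficients are symmetric, then $\|\varphi_n^H-\varphi\|_\infty=O(h^{2d+3})$. Here symmetric means: for $d+1\le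 i\le n$, $\sigma_{i,j}=\sigma_{i,j'}$ whenever $\xi_j$ and $\xi_{j'}$ are symmetric with respect to the centre of $[t_{i-d-1},t_i]$; and for $1\le i\le d$, $\sigma_{n+d+1-i,\,2n-j}=\sigma_{i,j}$ for all $0\le j\le 2n$. -/

import Mathlib

open Set Filter Topology MeasureTheory

namespace SplineQIP

noncomputable section

/-- The closed unit interval `[0, 1]`; the space `C[0, 1]` is `C(I, ℝ)` with the sup norm. -/
abbrev I : Type := unitInterval

/-- A function on `[0, 1]`, regarded as a function on `ℝ` (constant outside `[0, 1]`). -/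
def onReal (x : C(I, ℝ)) : ℝ → ℝ := Set.IccExtend (zero_le_one' ℝ) x

/-- `x ∈ C^m[0, 1]`. -/
def IsCm (m : ℕ) (x : C(I, ℝ)) : Prop := ContDiffOn ℝ m (onReal x) (Icc 0 1)

/-- For `x ∈ C^m[0, 1]`: the derivative of order `m + 1` is (essentially) bounded, in the weak
sense that `x^(m)` is Lipschitz on `[0, 1]`. -/
def HasBoundedNextDeriv (m : ℕ) (x : C(I, ℝ)) : Prop :=
  ∃ L : NNReal, LipschitzOnWith L (iteratedDerivWithin m (onReal x) (Icc 0 1)) (Icc 0 1)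

/-! ### The Urysohn operator -/

/-- The kernel `k(s, t, u)` is continuous for `s, t ∈ [0, 1]`, `u ∈ ℝ`. -/
def IsKernel (k : ℝ → ℝ → ℝ → ℝ) : Prop :=
  ContinuousOn (fun p : ℝ × ℝ × ℝ => k p.1 p.2.1 p.2.2) (Icc 0 1 ×ˢ Icc 0 1 ×ˢ univ)

theorem IsKernel.continuous_comp {k : ℝ → ℝ → ℝ → ℝ} (hk : IsKernel k) (x : C(I, ℝ)) :
    Continuous (fun p : I × I => k p.1 p.2 (x p.2)) := by
  refine ContinuousOn.comp_continuous
    (f := fun p : I × I => ((p.1 : ℝ), (p.2 : ℝ), x p.2)) hk (by fun_prop) ?_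
  intro p
  exact ⟨p.1.2, p.2.2, mem_univ _⟩

/-- The Urysohn operator `K(x)(s) = ∫₀¹ k(s, t, x(t)) dt` on `C[0, 1]`. -/
def urysohn (k : ℝ → ℝ → ℝ → ℝ) (hk : IsKernel k) (x : C(I, ℝ)) : C(I, ℝ) where
  toFun s := ∫ t : I, k s t (x t)
  continuous_toFun := by
    have h := continuous_parametric_integral_of_continuous (μ := (volume : Measure I))
      (f := fun s t : I => k s t (x t)) (hk.continuous_comp x) isCompact_univ
    simpa only [Measure.restrict_univ] using h

/-- The box `Ω = [0, 1] × [0, 1] × [a, b]`. -/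
def box (a b : ℝ) : Set (ℝ × ℝ × ℝ) := Icc 0 1 ×ˢ Icc 0 1 ×ˢ Icc a b

/-- `k ∈ C^m(Ω)`. -/
def KernelCm (m : ℕ) (a b : ℝ) (k : ℝ → ℝ → ℝ → ℝ) : Prop :=
  ContDiffOn ℝ m (fun p : ℝ × ℝ × ℝ => k p.1 p.2.1 p.2.2) (box a b)

/-- The partial derivative `∂k/∂u` for `u ∈ [a, b]` (one-sided at `a` and `b`). -/
def kernelDu (a b : ℝ) (k : ℝ → ℝ → ℝ → ℝ) (s t u : ℝ) : ℝ :=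
  derivWithin (fun v => k s t v) (Icc a b) u

/-! ### Splines -/

/-- The extended uniform knot sequence: `t_i = i / n` for `0 ≤ i ≤ n`, `t_i = 0` for `i < 0`
and `t_i = 1` for `i > n`. -/
def knot (n : ℕ) (i : ℤ) : ℝ := max 0 (min 1 ((i : ℝ) / n))

/-- Cox–de Boor recursion: `coxDeBoor n p m` is the B-spline of degree `p` with support
`[t_m, t_{m+p+1}]`. The last nonempty knot interval is closed at `1`, and a quotient with
denominator `0` counts as `0`. -/
def coxDeBoor (n : ℕ) : ℕ → ℤ → ℝ → ℝ
  | 0, m, t =>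
      open Classical in
      if (knot n m ≤ t ∧ t < knot n (m + 1)) ∨ (t = 1 ∧ knot n m < 1 ∧ knot n (m + 1) = 1)
      then 1 else 0
  | p + 1, m, t =>
      (t - knot n m) / (knot n (m + p + 1) - knot n m) * coxDeBoor n p m t
        + (knot n (m + p + 2) - t) / (knot n (m + p + 2) - knot n (m + 1))
          * coxDeBoor n p (m + 1) t

/-- The B-spline `B_i` of degree `d` with support `[t_{i-d-1}, t_i]`, for `1 ≤ i ≤ n + d`. -/
def bspline (d n i : ℕ) (t : ℝ) : ℝ := coxDeBoor n d ((i : ℤ) - d - 1) t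

/-- The space of splines of degree `d` and class `C^{d-1}` (`d ≥ 1`) on the uniform knots
`i / n`, `0 ≤ i ≤ n`, of `[0, 1]`. -/
def IsSpline (d n : ℕ) (x : C(I, ℝ)) : Prop :=
  IsCm (d - 1) x ∧
    ∀ i < n, ∃ p : Polynomial ℝ, p.natDegree ≤ d ∧
      ∀ t : I, (t : ℝ) ∈ Icc ((i : ℝ) / n) (((i : ℝ) + 1) / n) → x t = p.eval (t : ℝ)

/-! ### Quasi-interpolating projectors -/

/-- The quasi-interpolation nodes `ξ_j = j / (2n)`, `0 ≤ j ≤ 2n`: the knots and the midpoints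
of the knot intervals. -/
def node (n j : ℕ) : ℝ := (j : ℝ) / (2 * n)

/-- The coefficient functional `λ(x) = ∑_j c_j x(ξ_j)`. -/
def coeffFunctional (n : ℕ) (c : ℕ → ℝ) (x : C(I, ℝ)) : ℝ :=
  ∑ j ∈ Finset.range (2 * n + 1), c j * onReal x (node n j)

/-- `P` is the spline quasi-interpolating projector `P x = ∑ᵢ λᵢ(x) Bᵢ`, where
`λᵢ(x) = ∑ⱼ σᵢⱼ x(ξⱼ)` uses only nodes at distance at most `r h` (`h = 1 / n`) from the support
of `Bᵢ`; for `r = 0` these are the nodes in the support. -/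
structure IsQIP (d r n : ℕ) (σ : ℕ → ℕ → ℝ) (P : C(I, ℝ) →L[ℝ] C(I, ℝ)) : Prop where
  repr : ∀ (x : C(I, ℝ)) (s : I),
    P x s = ∑ i ∈ Finset.Icc 1 (n + d), coeffFunctional n (σ i) x * bspline d n i s
  is_local : ∀ i ∈ Finset.Icc 1 (n + d), ∀ j ≤ 2 * n, σ i j ≠ 0 →
    node n j ∈ Icc (knot n ((i : ℤ) - d - 1) - (r : ℝ) / n) (knot n i + (r : ℝ) / n)
  proj : ∀ x : C(I, ℝ), IsSpline d n x → P x = x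

/-- Symmetry of the coefficients. For `d + 1 ≤ i ≤ n`, nodes symmetric with respect to the centre
of the support `[t_{i-d-1}, t_i]` of `B_i` carry equal coefficients; for `1 ≤ i ≤ d`, the
functional of index `n + d + 1 - i` is the mirror image of the functional of index `i`
under `t ↦ 1 - t`. -/
structure IsSymmetric (d n : ℕ) (σ : ℕ → ℕ → ℝ) : Prop where
  interior : ∀ i ∈ Finset.Icc (d + 1) n, ∀ j ≤ 2 * n, ∀ j' ≤ 2 * n,
    node n j + node n j' = knot n ((i : ℤ) - d - 1) + knot n i → σ i j = σ i j'
  boundary : ∀ i ∈ Finset.Icc 1 d, ∀ j ≤ 2 * n, σ (n + d + 1 - i) (2 * n - j) = σ i j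

/-! ### The modified projection method -/

/-- `K_n^H(x) = P K(x) + K(P x) - P K(P x)`. -/
def modifiedOp (K : C(I, ℝ) → C(I, ℝ)) (P : C(I, ℝ) →L[ℝ] C(I, ℝ)) (x : C(I, ℝ)) : C(I, ℝ) :=
  P (K x) + K (P x) - P (K (P x))

end

end SplineQIP

open SplineQIP

namespace SplineQIP

noncomputable section

/-! Write `P` for the projector, `L` for the Fréchet derivative of `K` at `φ`, `e = P φ - φ` and `T
= K_n^H`.

Solvability is a contraction argument. Near `φ`, `T` differs from `L` by quadratic remainders and by
terms containing `P L - L`, which is small because `L` maps bounded sets to uniformly Lipschitz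
functions. As `L` is compact and `1` is not an eigenvalue, `R = (1 - L)⁻¹` exists, and the equation
becomes a fixed-point problem near `φ` (`exists_solution_modified`). The error is then at most `2
‖R‖` times the residual `T φ - K φ`.

The residual equals `-(P - I)(K(P φ) - K φ)`. Since `P` is local, bounded and reproduces polynomials
of degree `d`, `P - I` gains `h^(d+1)` times the size of the derivative of order `d + 1` of its
argument. Up to `O(‖e‖²)` that derivative is the integral of `e` against `∂_s^(d+1) ∂_u k(s, t,
φ(t))` (`exists_residual_bound`). With `‖e‖ = O(h^(d+1))` this gives order `2d + 2` for every `d`.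

For even `d` and symmetric coefficients the integral is one order smaller. On an interior knot
interval with midpoint `c`, `φ` is a Taylor polynomial of degree `d`, which is reproduced, plus a
multiple of `q = (t - c)^(d+1)`, plus a remainder `O(h^(d+2))`. The error `P q - q` is odd about
`c`: a symmetric functional kills the odd power centred at its own B-spline, so on `q` it acts as on
a polynomial of degree at most `d`, where reflection symmetry follows from linear independence of
the B-splines. Hence `e` integrates to `O(h^(d+3))` over the interval
(`IsQIP.integral_error_interval`). Against a Lipschitz weight these contributions sum to
`O(h^(d+2))`, and the boundedly many intervals near the ends cost no more (`abs_integral_mul_le`).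
-/

/-! ### Chains of derivatives and Taylor polynomials -/

/-- `X 0, …, X m` is a sequence of successive derivatives on `[0, 1]`. -/
def IsDerivChain (m : ℕ) (X : ℕ → ℝ → ℝ) : Prop :=
  ∀ j < m, ∀ s ∈ Icc (0 : ℝ) 1, HasDerivWithinAt (X j) (X (j + 1) s) (Icc 0 1) s

theorem IsDerivChain.mono {m m' : ℕ} {X : ℕ → ℝ → ℝ} (h : IsDerivChain m X) (hm : m' ≤ m) :
    IsDerivChain m' X := fun j hj => h j (hj.trans_le hm)

/-- The Taylor polynomial at `c` with `m` terms. -/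
def taylorPoly (X : ℕ → ℝ → ℝ) (m : ℕ) (c : ℝ) : Polynomial ℝ :=
  ∑ j ∈ Finset.range m,
    Polynomial.C (X j c / j.factorial) * (Polynomial.X - Polynomial.C c) ^ j

theorem natDegree_taylorPoly (X : ℕ → ℝ → ℝ) (m : ℕ) (c : ℝ) :
    (taylorPoly X (m + 1) c).natDegree ≤ m := by
  refine Polynomial.natDegree_sum_le_of_forall_le _ _ fun j hj => ?_
  refine (Polynomial.natDegree_C_mul_le _ _).trans ?_
  rw [(Polynomial.monic_X_sub_C c).natDegree_pow, Polynomial.natDegree_X_sub_C, mul_one]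
  exact Nat.lt_succ_iff.1 (Finset.mem_range.1 hj)

theorem derivative_taylorPoly (X : ℕ → ℝ → ℝ) (m : ℕ) (c : ℝ) :
    Polynomial.derivative (taylorPoly X (m + 1) c) = taylorPoly (fun j => X (j + 1)) m c := by
  rw [taylorPoly, Finset.sum_range_succ', taylorPoly]
  simp only [Polynomial.derivative_add, Polynomial.derivative_sum, Polynomial.derivative_C_mul,
    Polynomial.derivative_X_sub_C_pow, pow_zero, mul_one, Polynomial.derivative_C, add_zero]
  refine Finset.sum_congr rfl fun j _ => ?_
  rw [← mul_assoc, Nat.add_sub_cancel, ← Polynomial.C_mul]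
  congr 2
  have h1 : ((j + 1 : ℕ) : ℝ) ≠ 0 := by positivity
  rw [Nat.factorial_succ, Nat.cast_mul]
  field_simp

theorem eval_taylorPoly_self (X : ℕ → ℝ → ℝ) (m : ℕ) (c : ℝ) :
    (taylorPoly X (m + 1) c).eval c = X 0 c := by
  rw [taylorPoly, Finset.sum_range_succ']
  simp [Polynomial.eval_finsetSum]

/-- Taylor's formula with a Lipschitz bound on the last derivative. -/
theorem IsDerivChain.taylor_bound {m : ℕ} : ∀ {X : ℕ → ℝ → ℝ}, IsDerivChain m X → ∀ {M : ℝ},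
    (∀ s ∈ Icc (0 : ℝ) 1, ∀ t ∈ Icc (0 : ℝ) 1, |X m s - X m t| ≤ M * |s - t|) →
    ∀ c ∈ Icc (0 : ℝ) 1, ∀ s ∈ Icc (0 : ℝ) 1,
      |X 0 s - (taylorPoly X (m + 1) c).eval s| ≤ M * |s - c| ^ (m + 1) := by
  induction m with
  | zero =>
    intro X _ M hM c hc s hs
    simpa [taylorPoly] using hM s hs c hc
  | succ m ih =>
    intro X hX M hM c hc s hs
    have hX' : IsDerivChain m (fun j => X (j + 1)) := fun j hj => hX (j + 1) (by omega)
    have hsub : uIcc c s ⊆ Icc (0 : ℝ) 1 := (convex_Icc (0 : ℝ) 1).ordConnected.uIcc_subset hc hs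
    have hM0 : 0 ≤ M := by
      have := (abs_nonneg _).trans (hM 0 (by simp) 1 (by simp))
      simpa using this
    -- The derivative of the remainder is the remainder of the shifted chain, so the mean value
    -- inequality gains one power; the factorial is given away.
    have hder : ∀ y ∈ uIcc c s, HasDerivWithinAt
        (fun y => X 0 y - (taylorPoly X (m + 1 + 1) c).eval y)
        (X 1 y - (taylorPoly (fun j => X (j + 1)) (m + 1) c).eval y) (uIcc c s) y := by
      intro y hy
      refine ((hX 0 (by omega) y (hsub hy)).mono hsub).sub ?_
      rw [← derivative_taylorPoly]
      exact (Polynomial.hasDerivAt _ _).hasDerivWithinAt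
    have hbd : ∀ y ∈ uIcc c s,
        ‖X 1 y - (taylorPoly (fun j => X (j + 1)) (m + 1) c).eval y‖ ≤ M * |s - c| ^ (m + 1) := by
      intro y hy
      refine (ih hX' hM c hc y (hsub hy)).trans ?_
      have : |y - c| ≤ |s - c| := abs_sub_left_of_mem_uIcc hy
      gcongr
    have := Convex.norm_image_sub_le_of_norm_hasDerivWithin_le hder hbd (convex_uIcc c s)
      left_mem_uIcc right_mem_uIcc
    rw [eval_taylorPoly_self, sub_self, sub_zero, Real.norm_eq_abs, Real.norm_eq_abs] at this
    rw [pow_succ, ← mul_assoc]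
    exact this

theorem IsDerivChain.lipschitz_of_bound {m : ℕ} {X : ℕ → ℝ → ℝ} (h : IsDerivChain (m + 1) X)
    {M : ℝ} (hM : ∀ s ∈ Icc (0 : ℝ) 1, |X (m + 1) s| ≤ M) :
    ∀ s ∈ Icc (0 : ℝ) 1, ∀ t ∈ Icc (0 : ℝ) 1, |X m s - X m t| ≤ M * |s - t| :=
  fun _ hs _ ht => Convex.norm_image_sub_le_of_norm_hasDerivWithin_le
    (fun y hy => h m (Nat.lt_succ_self m) y hy) hM (convex_Icc 0 1) ht hs

/-- Derivatives within `[0, 1]` are unique. This links the chain built from the equation for `φ` to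
`HasBoundedNextDeriv`. -/
theorem IsDerivChain.iteratedDerivWithin_eq {m : ℕ} {X : ℕ → ℝ → ℝ} (h : IsDerivChain m X)
    {x : ℝ → ℝ} (hx : EqOn x (X 0) (Icc 0 1)) {j : ℕ} (hj : j ≤ m) :
    EqOn (iteratedDerivWithin j x (Icc 0 1)) (X j) (Icc 0 1) := by
  induction j with
  | zero => simpa using hx
  | succ j ih =>
    intro s hs
    rw [iteratedDerivWithin_succ, derivWithin_congr (ih (by omega)) (ih (by omega) hs)]
    exact (h j (by omega) s hs).derivWithin (uniqueDiffOn_Icc_zero_one s hs)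

theorem isDerivChain_iteratedDerivWithin {m : ℕ} {x : ℝ → ℝ}
    (hx : ContDiffOn ℝ m x (Icc 0 1)) :
    IsDerivChain m (fun j => iteratedDerivWithin j x (Icc 0 1)) := by
  intro j hj s hs
  beta_reduce
  rw [iteratedDerivWithin_succ]
  exact (hx.differentiableOn_iteratedDerivWithin (by exact_mod_cast hj)
    uniqueDiffOn_Icc_zero_one s hs).hasDerivWithinAt

/-! ### Differentiation under the integral sign on `[0, 1]` -/

/-- Dominated convergence for the slopes, which the mean value inequality bounds by `M`; the
derivatives are one-sided at `0` and `1`. -/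
theorem hasDerivWithinAt_integral_of_bound {Y : Type*} [MeasurableSpace Y] {μ : Measure Y}
    [IsFiniteMeasure μ] {F F' : ℝ → Y → ℝ} {M : ℝ}
    (hint : ∀ s ∈ Icc (0 : ℝ) 1, Integrable (F s) μ)
    (hder : ∀ᵐ y ∂μ, ∀ s ∈ Icc (0 : ℝ) 1,
      HasDerivWithinAt (fun s => F s y) (F' s y) (Icc 0 1) s ∧ |F' s y| ≤ M)
    {s : ℝ} (hs : s ∈ Icc (0 : ℝ) 1) :
    HasDerivWithinAt (fun s => ∫ y, F s y ∂μ) (∫ y, F' s y ∂μ) (Icc 0 1) s := by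
  rw [hasDerivWithinAt_iff_tendsto_slope]
  have hev : ∀ᶠ s' in 𝓝[Icc 0 1 \ {s}] s, s' ∈ Icc (0 : ℝ) 1 \ {s} := self_mem_nhdsWithin
  have hT : Tendsto (fun s' => ∫ y, slope (fun s => F s y) s s' ∂μ) (𝓝[Icc 0 1 \ {s}] s)
      (𝓝 (∫ y, F' s y ∂μ)) := by
    refine tendsto_integral_filter_of_dominated_convergence (fun _ => M) ?_ ?_
      (integrable_const M) ?_
    · filter_upwards [hev] with s' hs'
      simp only [slope_def_field]
      exact (((hint s' hs'.1).sub (hint s hs)).div_const _).aestronglyMeasurable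
    · filter_upwards [hev] with s' hs'
      filter_upwards [hder] with y hy
      have := Convex.norm_image_sub_le_of_norm_hasDerivWithin_le
        (fun z hz => (hy z hz).1) (fun z hz => (hy z hz).2) (convex_Icc 0 1) hs hs'.1
      rw [slope_def_field, norm_div, div_le_iff₀ (norm_pos_iff.2 (sub_ne_zero.2 hs'.2))]
      exact this
    · filter_upwards [hder] with y hy
      exact hasDerivWithinAt_iff_tendsto_slope.1 (hy s hs).1
  refine hT.congr' ?_
  filter_upwards [hev] with s' hs'
  simp only [slope_def_field]
  rw [integral_div, integral_sub (hint s' hs'.1) (hint s hs)]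

end

noncomputable section

/-! ### Partial derivatives of the kernel -/

theorem uniqueDiffOn_box {a b : ℝ} (hab : a < b) : UniqueDiffOn ℝ (box a b) :=
  uniqueDiffOn_Icc_zero_one.prod (uniqueDiffOn_Icc_zero_one.prod (uniqueDiffOn_Icc hab))

theorem isCompact_box (a b : ℝ) : IsCompact (box a b) :=
  isCompact_Icc.prod (isCompact_Icc.prod isCompact_Icc)

theorem convex_box (a b : ℝ) : Convex ℝ (box a b) :=
  (convex_Icc 0 1).prod ((convex_Icc 0 1).prod (convex_Icc a b))

/-- The iterated partial derivative `∂^j F / ∂s^j` on the box. -/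
def iterS (a b : ℝ) : ℕ → (ℝ × ℝ × ℝ → ℝ) → ℝ × ℝ × ℝ → ℝ
  | 0, F => F
  | j + 1, F => fun p => fderivWithin ℝ (iterS a b j F) (box a b) p (1, 0, 0)

theorem contDiffOn_iterS {a b : ℝ} (hab : a < b) {F : ℝ × ℝ × ℝ → ℝ} :
    ∀ {j m : ℕ}, ContDiffOn ℝ (m + j : ℕ) F (box a b) → ContDiffOn ℝ m (iterS a b j F) (box a b)
  | 0, m, h => h
  | j + 1, m, h => by
    have h1 : ContDiffOn ℝ (m + 1 : ℕ) (iterS a b j F) (box a b) :=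
      contDiffOn_iterS hab (by rwa [show m + 1 + j = m + (j + 1) by ring])
    exact (h1.fderivWithin (uniqueDiffOn_box hab) (by norm_cast)).clm_apply contDiffOn_const

theorem hasDerivWithinAt_iterS {a b : ℝ} (hab : a < b) {F : ℝ × ℝ × ℝ → ℝ} {j m : ℕ}
    (h : ContDiffOn ℝ m F (box a b)) (hj : j < m) {s t u : ℝ} (hs : s ∈ Icc (0 : ℝ) 1)
    (ht : t ∈ Icc (0 : ℝ) 1) (hu : u ∈ Icc a b) :
    HasDerivWithinAt (fun s => iterS a b j F (s, t, u)) (iterS a b (j + 1) F (s, t, u))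
      (Icc 0 1) s := by
  have h1 : ContDiffOn ℝ (1 : ℕ) (iterS a b j F) (box a b) :=
    contDiffOn_iterS hab (h.of_le (by exact_mod_cast (by omega : 1 + j ≤ m)))
  have h2 : HasFDerivWithinAt (iterS a b j F) _ (box a b) (s, t, u) :=
    (h1.differentiableOn (by simp) (s, t, u) ⟨hs, ht, hu⟩).hasFDerivWithinAt
  have h3 : HasDerivWithinAt (fun s : ℝ => ((s, t, u) : ℝ × ℝ × ℝ)) (1, 0, 0) (Icc 0 1) s :=
    (hasDerivWithinAt_id s _).prodMk (hasDerivWithinAt_const s _ _)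
  have h4 : MapsTo (fun s : ℝ => ((s, t, u) : ℝ × ℝ × ℝ)) (Icc 0 1) (box a b) :=
    fun s' hs' => ⟨hs', ht, hu⟩
  exact h2.comp_hasDerivWithinAt s h3 h4

theorem exists_lipschitz_iterS {a b : ℝ} (hab : a < b) {F : ℝ × ℝ × ℝ → ℝ} {j m : ℕ}
    (h : ContDiffOn ℝ m F (box a b)) (hj : j < m) :
    ∃ K : ℝ, 0 ≤ K ∧ ∀ p ∈ box a b, ∀ q ∈ box a b,
      |iterS a b j F p - iterS a b j F q| ≤ K * ‖p - q‖ := by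
  have h1 : ContDiffOn ℝ (1 : ℕ) (iterS a b j F) (box a b) :=
    contDiffOn_iterS hab (h.of_le (by exact_mod_cast (by omega : 1 + j ≤ m)))
  obtain ⟨K, hK⟩ := h1.exists_lipschitzOnWith (by simp) (convex_box a b) (isCompact_box a b)
  refine ⟨K, K.2, fun p hp q hq => ?_⟩
  have := hK.dist_le_mul p hp q hq
  rwa [Real.dist_eq, dist_eq_norm] at this

theorem exists_bound_iterS {a b : ℝ} (hab : a < b) {F : ℝ × ℝ × ℝ → ℝ} {j m : ℕ}
    (h : ContDiffOn ℝ m F (box a b)) (hj : j ≤ m) :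
    ∃ K : ℝ, ∀ p ∈ box a b, |iterS a b j F p| ≤ K := by
  have h1 : ContDiffOn ℝ (0 : ℕ) (iterS a b j F) (box a b) :=
    contDiffOn_iterS hab (h.of_le (by exact_mod_cast (by omega : 0 + j ≤ m)))
  exact (isCompact_box a b).exists_bound_of_continuousOn h1.continuousOn

theorem continuousOn_iterS {a b : ℝ} (hab : a < b) {F : ℝ × ℝ × ℝ → ℝ} {j m : ℕ}
    (h : ContDiffOn ℝ m F (box a b)) (hj : j ≤ m) : ContinuousOn (iterS a b j F) (box a b) :=
  (contDiffOn_iterS (m := 0) hab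
    (h.of_le (by exact_mod_cast (by omega : 0 + j ≤ m)))).continuousOn

/-- The kernel as a function of one variable. -/
def unc (k : ℝ → ℝ → ℝ → ℝ) (p : ℝ × ℝ × ℝ) : ℝ := k p.1 p.2.1 p.2.2

/-- Smoothness is given separately for `k` and `∂k/∂u`; this integrated identity replaces the
interchange of `∂_u` and `∂_s^j`. It is the fundamental theorem of calculus for `j = 0`, and
differentiating both sides in `s` raises `j`. -/
theorem iterS_sub_eq_integral {a b : ℝ} (hab : a < b) {k : ℝ → ℝ → ℝ → ℝ} {m : ℕ}
    (hm : 1 ≤ m) (hk : KernelCm m a b k) (hdk : KernelCm m a b (kernelDu a b k)) :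
    ∀ j ≤ m, ∀ s ∈ Icc (0 : ℝ) 1, ∀ t ∈ Icc (0 : ℝ) 1, ∀ u ∈ Icc a b, ∀ v ∈ Icc a b, u ≤ v →
      iterS a b j (unc k) (s, t, v) - iterS a b j (unc k) (s, t, u)
        = ∫ w in u..v, iterS a b j (unc (kernelDu a b k)) (s, t, w) := by
  have hcont : ∀ j ≤ m, ∀ s ∈ Icc (0 : ℝ) 1, ∀ t ∈ Icc (0 : ℝ) 1, ∀ u ∈ Icc a b, ∀ v ∈ Icc a b,
      u ≤ v → ContinuousOn (fun w => iterS a b j (unc (kernelDu a b k)) (s, t, w)) (Icc u v) := by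
    intro j hj s hs t ht u hu v hv huv
    refine (continuousOn_iterS hab hdk hj).comp (by fun_prop) ?_
    exact fun w hw => ⟨hs, ht, hu.1.trans hw.1, hw.2.trans hv.2⟩
  intro j
  induction j with
  | zero =>
    intro _ s hs t ht u hu v hv huv
    symm
    have hd : ∀ w ∈ Icc a b, HasDerivWithinAt (fun w => k s t w) (kernelDu a b k s t w)
        (Icc a b) w := by
      intro w hw
      refine DifferentiableWithinAt.hasDerivWithinAt ?_
      have h1 : DifferentiableOn ℝ (unc k) (box a b) :=
        ContDiffOn.differentiableOn hk (by exact_mod_cast (by omega : m ≠ 0))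
      have h2 : DifferentiableOn ℝ (fun w : ℝ => unc k (s, t, w)) (Icc a b) :=
        h1.comp (f := fun w : ℝ => ((s, t, w) : ℝ × ℝ × ℝ)) (by fun_prop)
          fun w hw => ⟨hs, ht, hw⟩
      exact h2 w hw
    refine intervalIntegral.integral_eq_sub_of_hasDerivAt_of_le huv
      (f := fun w => k s t w) ?_ ?_ ?_
    · exact fun w hw => ((hd w ⟨hu.1.trans hw.1, hw.2.trans hv.2⟩).continuousWithinAt).mono
        (Icc_subset_Icc hu.1 hv.2)
    · intro w hw
      have hw' : w ∈ Ioo a b := ⟨hu.1.trans_lt hw.1, hw.2.trans_le hv.2⟩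
      exact (hd w (Ioo_subset_Icc_self hw')).hasDerivAt (Icc_mem_nhds hw'.1 hw'.2)
    · exact ContinuousOn.intervalIntegrable_of_Icc huv
        (hcont 0 (by omega) s hs t ht u hu v hv huv)
  | succ j ih =>
    intro hj s hs t ht u hu v hv huv
    obtain ⟨M, hM⟩ := exists_bound_iterS hab hdk hj
    have h1 := (hasDerivWithinAt_iterS hab hk (show j < m from hj) hs ht hv).sub
      (hasDerivWithinAt_iterS hab hk (show j < m from hj) hs ht hu)
    have h2 := hasDerivWithinAt_integral_of_bound (μ := volume.restrict (Ioc u v))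
      (F := fun s w => iterS a b j (unc (kernelDu a b k)) (s, t, w))
      (F' := fun s w => iterS a b (j + 1) (unc (kernelDu a b k)) (s, t, w)) (M := M)
      (fun s hs => ((hcont j (by omega) s hs t ht u hu v hv huv).integrableOn_Icc).mono_set
        Ioc_subset_Icc_self)
      ((ae_restrict_iff' measurableSet_Ioc).2 (Eventually.of_forall fun w hw s hs => by
        have hw' : w ∈ Icc a b := ⟨hu.1.trans hw.1.le, hw.2.trans hv.2⟩
        exact ⟨hasDerivWithinAt_iterS hab hdk (show j < m from hj) hs ht hw',
          hM _ ⟨hs, ht, hw'⟩⟩)) hs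
    have h3 := h2.congr_of_mem (f₁ := fun s => iterS a b j (unc k) (s, t, v) -
      iterS a b j (unc k) (s, t, u)) (fun s hs => by
        rw [ih (by omega) s hs t ht u hu v hv huv, intervalIntegral.integral_of_le huv]) hs
    rw [intervalIntegral.integral_of_le huv]
    exact (uniqueDiffOn_Icc_zero_one s hs).eq_deriv _ h1 h3

/-- First-order expansion of `∂^j k / ∂s^j` in the variable `u`. -/
theorem exists_iterS_expansion {a b : ℝ} (hab : a < b) {k : ℝ → ℝ → ℝ → ℝ} {m j : ℕ}
    (hk : KernelCm m a b k) (hdk : KernelCm m a b (kernelDu a b k))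
    (hdk' : KernelCm (m + 1) a b (kernelDu a b k)) (hm : 1 ≤ m) (hj : j ≤ m) :
    ∃ K : ℝ, 0 ≤ K ∧ ∀ s ∈ Icc (0 : ℝ) 1, ∀ t ∈ Icc (0 : ℝ) 1, ∀ u ∈ Icc a b, ∀ v ∈ Icc a b,
      ∀ w ∈ Icc a b, |iterS a b j (unc k) (s, t, v) - iterS a b j (unc k) (s, t, u)
        - iterS a b j (unc (kernelDu a b k)) (s, t, w) * (v - u)|
          ≤ K * (|v - w| + |u - w|) * |v - u| := by
  obtain ⟨K, hK0, hK⟩ := exists_lipschitz_iterS hab hdk' (show j < m + 1 by omega)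
  refine ⟨K, hK0, fun s hs t ht u hu v hv w hw => ?_⟩
  -- The estimate is symmetric in `u` and `v`. For `u ≤ v`, a point between them is no farther from
  -- `w` than one of the two ends.
  wlog huv : u ≤ v generalizing u v
  · have := this v hv u hu (le_of_not_ge huv)
    rw [← abs_neg, abs_sub_comm v u, add_comm]
    convert this using 2
    ring
  have hc : ContinuousOn (fun z => iterS a b j (unc (kernelDu a b k)) (s, t, z)) (Icc u v) :=
    (continuousOn_iterS hab hdk hj).comp (by fun_prop)
      fun z hz => ⟨hs, ht, hu.1.trans hz.1, hz.2.trans hv.2⟩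
  have h1 : iterS a b j (unc k) (s, t, v) - iterS a b j (unc k) (s, t, u)
        - iterS a b j (unc (kernelDu a b k)) (s, t, w) * (v - u) =
      ∫ z in u..v, (iterS a b j (unc (kernelDu a b k)) (s, t, z) -
        iterS a b j (unc (kernelDu a b k)) (s, t, w)) := by
    rw [intervalIntegral.integral_sub (hc.intervalIntegrable_of_Icc huv) (by simp),
      ← iterS_sub_eq_integral hab hm hk hdk j hj s hs t ht u hu v hv huv]
    simp [mul_comm]
  rw [h1, ← Real.norm_eq_abs]
  refine intervalIntegral.norm_integral_le_of_norm_le_const fun z hz => ?_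
  rw [uIoc_of_le huv] at hz
  have hz' : z ∈ Icc a b := ⟨hu.1.trans hz.1.le, hz.2.trans hv.2⟩
  refine (hK (s, t, z) ⟨hs, ht, hz'⟩ (s, t, w) ⟨hs, ht, hw⟩).trans ?_
  have : ‖((s, t, z) : ℝ × ℝ × ℝ) - (s, t, w)‖ = |z - w| := by simp [Prod.norm_def]
  rw [this]
  gcongr
  rcases le_total z w with h | h
  · have := hz.1
    rw [abs_of_nonpos (by linarith), abs_of_nonpos (show u - w ≤ 0 by linarith)]
    linarith [abs_nonneg (v - w)]
  · have := hz.2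
    rw [abs_of_nonneg (by linarith), abs_of_nonneg (show 0 ≤ v - w by linarith)]
    linarith [abs_nonneg (u - w)]

end

noncomputable section

/-! ### Supports of B-splines -/

theorem knot_mono (n : ℕ) {i j : ℤ} (h : i ≤ j) : knot n i ≤ knot n j := by
  unfold knot
  have : (i : ℝ) ≤ j := by exact_mod_cast h
  gcongr

theorem knot_eq {n : ℕ} (hn : 0 < n) {i : ℤ} (h0 : 0 ≤ i) (h1 : i ≤ n) : knot n i = i / n := by
  have hn' : (0 : ℝ) < n := by exact_mod_cast hn
  have h0' : (0 : ℝ) ≤ i := by exact_mod_cast h0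
  have h1' : (i : ℝ) ≤ n := by exact_mod_cast h1
  rw [knot, min_eq_right ((div_le_one hn').2 h1'), max_eq_right (by positivity)]

theorem knot_sub_le (n : ℕ) {i j : ℤ} (h : i ≤ j) : knot n j - knot n i ≤ (j - i) / n := by
  have h' : (i : ℝ) ≤ j := by exact_mod_cast h
  have h2 : (i : ℝ) / n ≤ j / n := by gcongr
  rw [sub_div]
  unfold knot
  rcases max_cases (0 : ℝ) (min 1 ((i : ℝ) / n)) with h3 | h3 <;>
  rcases max_cases (0 : ℝ) (min 1 ((j : ℝ) / n)) with h4 | h4 <;>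
  rcases min_cases (1 : ℝ) ((i : ℝ) / n) with h5 | h5 <;>
  rcases min_cases (1 : ℝ) ((j : ℝ) / n) with h6 | h6 <;> linarith

theorem mem_of_coxDeBoor_ne_zero {n : ℕ} {t : ℝ} : ∀ {p : ℕ} {m : ℤ}, coxDeBoor n p m t ≠ 0 →
    t ∈ Icc (knot n m) (knot n (m + p + 1))
  | 0, m, h => by
    rw [coxDeBoor] at h
    have h' := (ite_ne_right_iff.1 h).1
    rw [Nat.cast_zero, add_zero]
    rcases h' with h' | h'
    · exact ⟨h'.1, h'.2.le⟩
    · exact ⟨by rw [h'.1]; exact h'.2.1.le, by rw [h'.1, h'.2.2]⟩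
  | p + 1, m, h => by
    rw [coxDeBoor] at h
    by_cases h1 : coxDeBoor n p m t = 0
    · have h2 : coxDeBoor n p (m + 1) t ≠ 0 := by
        rintro h2
        simp [h1, h2] at h
      have := mem_of_coxDeBoor_ne_zero h2
      refine ⟨(knot_mono n (by omega)).trans this.1, this.2.trans (knot_mono n ?_)⟩
      push_cast; omega
    · have := mem_of_coxDeBoor_ne_zero h1
      refine ⟨this.1, this.2.trans (knot_mono n ?_)⟩
      push_cast; omega

theorem mem_of_bspline_ne_zero {d n i : ℕ} {t : ℝ} (h : bspline d n i t ≠ 0) :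
    t ∈ Icc (knot n ((i : ℤ) - d - 1)) (knot n i) := by
  have := mem_of_coxDeBoor_ne_zero h
  rwa [show (i : ℤ) - d - 1 + d + 1 = i by ring] at this

/-! ### Locality of quasi-interpolating projectors -/

theorem node_mem {n j : ℕ} (hj : j ≤ 2 * n) : node n j ∈ Icc (0 : ℝ) 1 := by
  have : (j : ℝ) ≤ 2 * n := by exact_mod_cast hj
  exact ⟨by unfold node; positivity, div_le_one_of_le₀ this (by positivity)⟩

theorem onReal_apply (x : C(I, ℝ)) {t : ℝ} (ht : t ∈ Icc (0 : ℝ) 1) : onReal x t = x ⟨t, ht⟩ :=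
  IccExtend_of_mem _ _ ht

theorem onReal_coe (x : C(I, ℝ)) (t : I) : onReal x t = x t :=
  IccExtend_val _ _ t

theorem continuous_onReal (x : C(I, ℝ)) : Continuous (onReal x) :=
  x.continuous.Icc_extend'

/-- A polynomial as an element of `C[0, 1]`. -/
def polyC (p : Polynomial ℝ) : C(I, ℝ) := ⟨fun t => p.eval (t : ℝ), by fun_prop⟩

@[simp] theorem polyC_apply (p : Polynomial ℝ) (t : I) : polyC p t = p.eval (t : ℝ) := rfl

theorem isSpline_polyC {d n : ℕ} {p : Polynomial ℝ} (hp : p.natDegree ≤ d) :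
    IsSpline d n (polyC p) := by
  refine ⟨?_, fun i _ => ⟨p, hp, fun t _ => rfl⟩⟩
  have h : ContDiff ℝ (d - 1 : ℕ) (fun t : ℝ => p.eval t) :=
    p.contDiff_aeval _
  exact h.contDiffOn.congr fun t ht => by rw [onReal_apply _ ht]; rfl

variable {d r n : ℕ} {σ : ℕ → ℕ → ℝ} {P : C(I, ℝ) →L[ℝ] C(I, ℝ)}

/-- If `B_i(s) ≠ 0`, then `s` lies in the support of `B_i` and the nodes used by `λ_i` in its
enlargement by `r h`; their distance is at most `(d + 1) h + r h`. -/
theorem IsQIP.congr (h : IsQIP d r n σ P) {x y : C(I, ℝ)} {s : I}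
    (hxy : ∀ t : I, |(t : ℝ) - s| ≤ (d + r + 1) / n → x t = y t) : P x s = P y s := by
  rw [h.repr, h.repr]
  refine Finset.sum_congr rfl fun i hi => ?_
  by_cases hb : bspline d n i s = 0
  · rw [hb, mul_zero, mul_zero]
  congr 1
  refine Finset.sum_congr rfl fun j hj => ?_
  have hj' : j ≤ 2 * n := Nat.lt_succ_iff.1 (Finset.mem_range.1 hj)
  by_cases hc : σ i j = 0
  · rw [hc, zero_mul, zero_mul]
  rw [onReal_apply _ (node_mem hj'), onReal_apply _ (node_mem hj')]
  rw [hxy]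
  have h1 := h.is_local i hi j hj' hc
  have h2 := mem_of_bspline_ne_zero hb
  have h3 := knot_sub_le n (show (i : ℤ) - d - 1 ≤ i by omega)
  have h4 : (((i : ℤ) : ℝ) - ((i : ℤ) - d - 1 : ℤ)) / n + r / n = (d + r + 1) / n := by
    push_cast; ring
  rw [abs_le]
  constructor <;> linarith [h1.1, h1.2, h2.1, h2.2]

/-- Truncating `x` at height `η` changes nothing near `s` and makes the sup norm at most `η`. So the
operator norm alone bounds `P` locally, without estimates of the coefficients. -/
theorem IsQIP.local_bound (h : IsQIP d r n σ P) {x : C(I, ℝ)} {s : I} {η : ℝ} (hη : 0 ≤ η)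
    (hx : ∀ t : I, |(t : ℝ) - s| ≤ (d + r + 1) / n → |x t| ≤ η) : |P x s| ≤ ‖P‖ * η := by
  let y : C(I, ℝ) := ⟨fun t => max (-η) (min η (x t)), by fun_prop⟩
  have hy : ‖y‖ ≤ η := by
    rw [ContinuousMap.norm_le _ hη]
    intro t
    rw [Real.norm_eq_abs, abs_le]
    exact ⟨le_max_left _ _, max_le (by linarith) (min_le_left _ _)⟩
  have hxy : P x s = P y s := h.congr fun t ht => by
    have := abs_le.1 (hx t ht)
    exact (by rw [min_eq_right this.2, max_eq_right this.1] : max (-η) (min η (x t)) = x t).symm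
  rw [hxy]
  exact ((P y).norm_coe_le_norm s).trans ((P.le_opNorm y).trans (by gcongr))

/-- `P - I` annihilates `p`, so `x` may be replaced by `x - p`, which need be small only near `s`.
-/
theorem IsQIP.local_error (h : IsQIP d r n σ P) {x : C(I, ℝ)} {s : I} {η : ℝ} (hη : 0 ≤ η)
    {p : Polynomial ℝ} (hp : p.natDegree ≤ d)
    (hx : ∀ t : I, |(t : ℝ) - s| ≤ (d + r + 1) / n → |x t - p.eval (t : ℝ)| ≤ η) :
    |P x s - x s| ≤ (‖P‖ + 1) * η := by
  have h1 : P x s - x s = P (x - polyC p) s - (x - polyC p) s := by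
    rw [map_sub, h.proj _ (isSpline_polyC hp)]
    simp
  have h2 : |P (x - polyC p) s| ≤ ‖P‖ * η := h.local_bound hη hx
  have h3 : |(x - polyC p) s| ≤ η := hx s (by rw [sub_self, abs_zero]; positivity)
  rw [h1]
  exact (abs_sub _ _).trans (by linarith)

/-- The comparison polynomial is the Taylor polynomial at the evaluation point `s` itself; it may
change with `s`. -/
theorem IsQIP.error_of_derivChain (h : IsQIP d r n σ P) {x : C(I, ℝ)} {X : ℕ → ℝ → ℝ} {m : ℕ}
    (hm : m ≤ d) (hX : IsDerivChain m X) (hx : ∀ t : I, x t = X 0 t) {M : ℝ} (hM0 : 0 ≤ M)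
    (hM : ∀ s ∈ Icc (0 : ℝ) 1, ∀ t ∈ Icc (0 : ℝ) 1, |X m s - X m t| ≤ M * |s - t|) :
    ‖P x - x‖ ≤ (‖P‖ + 1) * (M * ((d + r + 1) / n) ^ (m + 1)) := by
  rw [ContinuousMap.norm_le _ (by positivity)]
  intro s
  refine h.local_error (p := taylorPoly X (m + 1) s) (by positivity)
    ((natDegree_taylorPoly _ _ _).trans hm) fun t ht => ?_
  rw [hx]
  exact (hX.taylor_bound hM s s.2 t t.2).trans (by gcongr)

/-- Applied to the functions `L v`, this makes `P L - L` small in operator norm. -/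
theorem IsQIP.error_of_lipschitz (h : IsQIP d r n σ P) {x : C(I, ℝ)} {M : ℝ} (hM0 : 0 ≤ M)
    (hM : ∀ s t : I, |x s - x t| ≤ M * |(s : ℝ) - t|) :
    ‖P x - x‖ ≤ (‖P‖ + 1) * (M * ((d + r + 1) / n)) := by
  have := h.error_of_derivChain (x := x) (X := fun _ => onReal x) (m := 0) (Nat.zero_le d)
    (fun j hj => by omega) (fun t => (onReal_coe x t).symm) hM0 (fun s hs t ht => by
      rw [onReal_apply _ hs, onReal_apply _ ht]
      exact hM _ _)
  simpa using this

end

noncomputable section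

/-! ### B-splines on an interior knot interval -/

theorem coxDeBoor_zero_interior {n j : ℕ} (hjn : j + 1 ≤ n) {t : ℝ}
    (ht : t ∈ Ioo ((j : ℝ) / n) ((j + 1) / n)) {m : ℤ} (h0 : 0 ≤ m) (h1 : m + 1 ≤ n) :
    coxDeBoor n 0 m t = if m = j then 1 else 0 := by
  have hn : 0 < n := by omega
  have hn' : (0 : ℝ) < n := by exact_mod_cast hn
  have hjn' : ((j : ℝ) + 1) ≤ n := by exact_mod_cast hjn
  have ht1 : t ≠ 1 := fun h => by
    have := ht.2
    rw [h, lt_div_iff₀ hn'] at this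
    linarith
  rw [coxDeBoor, knot_eq hn h0 (by omega), knot_eq hn (by omega) h1]
  refine if_congr ?_ rfl rfl
  have e1 := (div_lt_iff₀ hn').1 ht.1
  have e2 := (lt_div_iff₀ hn').1 ht.2
  constructor
  · rintro (h | h)
    · have h3 := (div_le_iff₀ hn').1 h.1
      have h4 := (lt_div_iff₀ hn').1 h.2
      have h5 : (m : ℝ) < (j + 1 : ℤ) := by push_cast; linarith
      have h6 : ((j : ℤ) : ℝ) < (m + 1 : ℤ) := by push_cast at h4 ⊢; linarith
      have h5' := Int.cast_lt.1 h5
      have h6' := Int.cast_lt.1 h6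
      omega
    · exact absurd h.1 ht1
  · rintro rfl
    left
    push_cast
    exact ⟨ht.1.le, ht.2⟩

/-- Reflection of the uniform B-splines in the centre of a knot interval. -/
theorem coxDeBoor_reflect {n j : ℕ} (hjn : j + 1 ≤ n) {t : ℝ}
    (ht : t ∈ Ioo ((j : ℝ) / n) ((j + 1) / n)) : ∀ {p : ℕ} {m : ℤ}, 0 ≤ m → m + p + 1 ≤ n →
      0 ≤ 2 * j - p - m → 2 * j - m + 1 ≤ n →
      coxDeBoor n p (2 * j - p - m) ((2 * j + 1) / n - t) = coxDeBoor n p m t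
  | 0, m, h0, h1, h2, h3 => by
    have ht' : (2 * j + 1) / n - t ∈ Ioo ((j : ℝ) / n) ((j + 1) / n) := by
      have e : ((2 * j + 1 : ℝ) / n) = j / n + (j + 1) / n := by ring
      rw [e]
      constructor <;> linarith [ht.1, ht.2]
    rw [coxDeBoor_zero_interior hjn ht (by omega) (by push_cast at h1; omega),
      coxDeBoor_zero_interior hjn ht' (by omega) (by push_cast at h1 ⊢; omega)]
    refine if_congr ?_ rfl rfl
    push_cast
    omega
  | p + 1, m, h0, h1, h2, h3 => by
    have hn : 0 < n := by omega
    have hn' : (n : ℝ) ≠ 0 := by positivity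
    push_cast at h1 h2
    have i1 := coxDeBoor_reflect hjn ht (p := p) (m := m) h0 (by omega) (by omega) h3
    have i2 := coxDeBoor_reflect hjn ht (p := p) (m := m + 1) (by omega) (by omega) (by omega)
      (by omega)
    -- All knots are unclamped, so every denominator is `(p + 1) / n`, and the reflection exchanges
    -- the two terms of the recursion.
    have e1 : (2 * j - (p + 1 : ℕ) - m : ℤ) = 2 * j - p - (m + 1) := by push_cast; ring
    have e2 : (2 * j - p - (m + 1) + 1 : ℤ) = 2 * j - p - m := by ring
    rw [coxDeBoor, coxDeBoor, e1, i2, e2, i1, knot_eq hn h0 (by omega),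
      knot_eq hn (i := m + 1) (by omega) (by omega),
      knot_eq hn (i := m + p + 1) (by omega) (by omega),
      knot_eq hn (i := m + p + 2) (by omega) (by omega),
      knot_eq hn (i := 2 * j - p - (m + 1)) (by omega) (by omega),
      knot_eq hn (i := 2 * j - p - m) (by omega) (by omega),
      knot_eq hn (i := 2 * j - p - (m + 1) + p + 1) (by omega) (by omega),
      knot_eq hn (i := 2 * j - p - (m + 1) + p + 2) (by omega) (by omega)]
    push_cast
    have hp : (p : ℝ) + 1 ≠ 0 := by positivity
    have d1 : ((m : ℝ) + p + 1) / n - m / n = (p + 1) / n := by ring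
    have d2 : ((m : ℝ) + p + 2) / n - (m + 1) / n = (p + 1) / n := by ring
    have d3 : (2 * (j : ℝ) - p - (m + 1) + p + 1) / n - (2 * j - p - (m + 1)) / n
      = (p + 1) / n := by ring
    have d4 : (2 * (j : ℝ) - p - (m + 1) + p + 2) / n - (2 * j - p - m) / n
      = (p + 1) / n := by ring
    rw [d1, d2, d3, d4]
    ring

/-- Only `B_{j+1}, …, B_{j+1+d}` live on this interval. The bounds on `j` keep their knots uniformly
spaced, and the reflection reverses their order. -/
theorem bspline_reflect {d n j : ℕ} (hdj : d ≤ j) (hjn : j + d + 1 ≤ n) {t : ℝ}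
    (ht : t ∈ Ioo ((j : ℝ) / n) ((j + 1) / n)) {m : ℕ} (hm : m ≤ d) :
    bspline d n (j + 1 + (d - m)) ((2 * j + 1) / n - t) = bspline d n (j + 1 + m) t := by
  have := coxDeBoor_reflect (n := n) (j := j) (by omega) ht (p := d) (m := j + m - d)
    (by omega) (by omega) (by omega) (by omega)
  unfold bspline
  rw [show ((j + 1 + m : ℕ) : ℤ) - d - 1 = j + m - d by push_cast; ring, ← this]
  congr 1
  push_cast [hm]
  ring

theorem bspline_eq_zero {d n j : ℕ} (hjn : j + 1 ≤ n) {t : ℝ}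
    (ht : t ∈ Ioo ((j : ℝ) / n) ((j + 1) / n)) {i : ℕ}
    (hi : i ∉ Finset.Ico (j + 1) (j + 1 + (d + 1))) :
    bspline d n i t = 0 := by
  by_contra hne
  have hn : 0 < n := by omega
  have h := mem_of_bspline_ne_zero hne
  have k1 : knot n (j : ℤ) = j / n := by rw [knot_eq hn (by omega) (by omega)]; simp
  have k2 : knot n ((j : ℤ) + 1) = (j + 1) / n := by
    rw [knot_eq hn (by omega) (by omega)]; simp
  rw [Finset.mem_Ico, not_and_or] at hi
  rcases hi with hi | hi
  · have := knot_mono n (show (i : ℤ) ≤ j by omega)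
    linarith [h.2, ht.1]
  · have := knot_mono n (show (j : ℤ) + 1 ≤ (i : ℤ) - d - 1 by omega)
    linarith [h.1, ht.2]

/-! ### Coefficients of the projector on one knot interval -/

variable {d r n : ℕ} {σ : ℕ → ℕ → ℝ} {P : C(I, ℝ) →L[ℝ] C(I, ℝ)}

theorem Ioo_subset_unit {j n : ℕ} (hjn : j + 1 ≤ n) {t : ℝ}
    (ht : t ∈ Ioo ((j : ℝ) / n) ((j + 1) / n)) : t ∈ Icc (0 : ℝ) 1 := by
  have hjn' : ((j : ℝ) + 1) ≤ n := by exact_mod_cast hjn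
  exact ⟨le_trans (by positivity) ht.1.le, ht.2.le.trans (div_le_one_of_le₀ hjn' (by positivity))⟩

theorem IsQIP.repr_interval (h : IsQIP d r n σ P) {j : ℕ} (hjn : j + 1 ≤ n) {t : ℝ}
    (ht : t ∈ Ioo ((j : ℝ) / n) ((j + 1) / n)) (x : C(I, ℝ)) :
    P x ⟨t, Ioo_subset_unit hjn ht⟩ = ∑ m : Fin (d + 1),
      coeffFunctional n (σ (j + 1 + m)) x * bspline d n (j + 1 + m) t := by
  rw [h.repr, Fin.sum_univ_eq_sum_range
    (fun m => coeffFunctional n (σ (j + 1 + m)) x * bspline d n (j + 1 + m) t)]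
  have := Finset.sum_Ico_eq_sum_range
    (fun i => coeffFunctional n (σ i) x * bspline d n i t) (j + 1) (j + 1 + (d + 1))
  rw [Nat.add_sub_cancel_left] at this
  rw [← this]
  symm
  refine Finset.sum_subset (fun i hi => ?_) fun i _ hi => ?_
  · rw [Finset.mem_Ico] at hi
    rw [Finset.mem_Icc]
    omega
  · rw [bspline_eq_zero hjn ht hi, mul_zero]

/-- A coefficient functional on polynomials. -/
def coeffPoly (n : ℕ) (c : ℕ → ℝ) : Polynomial ℝ →ₗ[ℝ] ℝ :=
  ∑ j ∈ Finset.range (2 * n + 1), c j • Polynomial.leval (node n j)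

theorem coeffPoly_apply (n : ℕ) (c : ℕ → ℝ) (p : Polynomial ℝ) :
    coeffPoly n c p = ∑ j ∈ Finset.range (2 * n + 1), c j * p.eval (node n j) := by
  simp [coeffPoly, LinearMap.sum_apply]

theorem coeffFunctional_polyC (n : ℕ) (c : ℕ → ℝ) (p : Polynomial ℝ) :
    coeffFunctional n c (polyC p) = coeffPoly n c p := by
  rw [coeffPoly_apply]
  refine Finset.sum_congr rfl fun j hj => ?_
  rw [onReal_apply _ (node_mem (Nat.lt_succ_iff.1 (Finset.mem_range.1 hj)))]
  rfl

theorem IsQIP.eval_eq_sum (h : IsQIP d r n σ P) {j : ℕ} (hjn : j + 1 ≤ n) {t : ℝ}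
    (ht : t ∈ Ioo ((j : ℝ) / n) ((j + 1) / n)) {p : Polynomial ℝ} (hp : p.natDegree ≤ d) :
    p.eval t = ∑ m : Fin (d + 1), coeffPoly n (σ (j + 1 + m)) p * bspline d n (j + 1 + m) t := by
  have := h.repr_interval hjn ht (polyC p)
  rw [h.proj _ (isSpline_polyC hp)] at this
  simpa only [coeffFunctional_polyC, polyC_apply] using this

/-- The B-splines of a knot interval are linearly independent there: they span the polynomials
of degree at most `d`. -/
theorem IsQIP.linearIndependent_bspline (h : IsQIP d r n σ P) {j : ℕ} (hjn : j + 1 ≤ n) :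
    LinearIndependent ℝ (fun (m : Fin (d + 1)) (t : Ioo ((j : ℝ) / n) ((j + 1) / n)) =>
      bspline d n (j + 1 + m) t) := by
  have hn : (0 : ℝ) < n := by exact_mod_cast (by omega : 0 < n)
  have hlt : (j : ℝ) / n < (j + 1) / n := by gcongr; linarith
  rw [linearIndependent_iff_card_le_finrank_span, Fintype.card_fin]
  let ev : Polynomial.degreeLT ℝ (d + 1) →ₗ[ℝ] (Ioo ((j : ℝ) / n) ((j + 1) / n) → ℝ) :=
    { toFun := fun p t => (p : Polynomial ℝ).eval (t : ℝ)
      map_add' := fun p q => by ext; simp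
      map_smul' := fun c p => by ext; simp }
  have hinj : Function.Injective ev := by
    intro p q hpq
    refine Subtype.ext (Polynomial.eq_of_infinite_eval_eq _ _ ?_)
    refine (Ioo_infinite hlt).mono fun t ht => ?_
    exact congrFun hpq ⟨t, ht⟩
  have h1 : Module.finrank ℝ (LinearMap.range ev) = d + 1 := by
    rw [LinearMap.finrank_range_of_inj hinj,
      (Polynomial.degreeLTEquiv ℝ (d + 1)).finrank_eq, Module.finrank_fin_fun]
  set v := fun (m : Fin (d + 1)) (t : Ioo ((j : ℝ) / n) ((j + 1) / n)) =>
    bspline d n (j + 1 + m) t with hv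
  -- By reproduction, polynomials of degree at most `d` are combinations of these `d + 1` functions,
  -- whose span therefore has dimension at least `d + 1`.
  have hle : LinearMap.range ev ≤ Submodule.span ℝ (range v) := by
    rintro _ ⟨p, rfl⟩
    have hp : (p : Polynomial ℝ).natDegree ≤ d := by
      have := Polynomial.mem_degreeLT.1 p.2
      exact Polynomial.natDegree_le_iff_degree_le.2 (Order.le_of_lt_succ this)
    have : ev p = ∑ m : Fin (d + 1), coeffPoly n (σ (j + 1 + m)) (p : Polynomial ℝ) •
        (fun t : Ioo ((j : ℝ) / n) ((j + 1) / n) => bspline d n (j + 1 + m) t) := by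
      ext t
      have hev : ev p t = (p : Polynomial ℝ).eval (t : ℝ) := rfl
      simpa [Finset.sum_apply, hv] using hev.trans (h.eval_eq_sum hjn t.2 hp)
    rw [this]
    exact Submodule.sum_mem _ fun m _ => Submodule.smul_mem _ _
      (Submodule.subset_span ⟨m, rfl⟩)
  have : Module.Finite ℝ (Submodule.span ℝ (range v)) :=
    FiniteDimensional.span_of_finite ℝ (Set.finite_range v)
  exact h1.symm.le.trans (Submodule.finrank_mono hle)

/-- The reflection of a polynomial in the point `c / 2`. -/
def reflectPoly (c : ℝ) (p : Polynomial ℝ) : Polynomial ℝ :=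
  p.comp (Polynomial.C c - Polynomial.X)

theorem eval_reflectPoly (c : ℝ) (p : Polynomial ℝ) (t : ℝ) :
    (reflectPoly c p).eval t = p.eval (c - t) := by
  simp [reflectPoly]

theorem natDegree_reflectPoly_le {c : ℝ} {p : Polynomial ℝ} (hp : p.natDegree ≤ d) :
    (reflectPoly c p).natDegree ≤ d := by
  refine Polynomial.natDegree_comp_le.trans ?_
  have : (Polynomial.C c - Polynomial.X : Polynomial ℝ).natDegree ≤ 1 :=
    (Polynomial.natDegree_sub_le _ _).trans (by simp)
  calc _ ≤ d * 1 := Nat.mul_le_mul hp this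
    _ = d := mul_one d

/-- On polynomials of degree at most `d`, the coefficients commute with the reflection in the
centre of an interior knot interval. -/
theorem IsQIP.coeffPoly_reflect (h : IsQIP d r n σ P) {j : ℕ} (hdj : d ≤ j)
    (hjn : j + d + 1 ≤ n) {p : Polynomial ℝ} (hp : p.natDegree ≤ d) {m : ℕ} (hm : m ≤ d) :
    coeffPoly n (σ (j + 1 + (d - m))) (reflectPoly ((2 * j + 1) / n) p)
      = coeffPoly n (σ (j + 1 + m)) p := by
  have hjn' : j + 1 ≤ n := by omega
  set c : ℝ := (2 * j + 1) / n with hc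
  -- The value `p(c - t)` is expanded twice: with the coefficients of the reflected polynomial at
  -- `t`, and with those of `p` at `c - t`, the splines being reflected back to `t`.
  have key : ∑ m : Fin (d + 1), (coeffPoly n (σ (j + 1 + m)) (reflectPoly c p)
      - coeffPoly n (σ (j + 1 + (d - m))) p) •
      (fun t : Ioo ((j : ℝ) / n) ((j + 1) / n) => bspline d n (j + 1 + m) t) = 0 := by
    ext ⟨t, ht⟩
    have ht' : c - t ∈ Ioo ((j : ℝ) / n) ((j + 1) / n) := by
      have e : c = j / n + (j + 1) / n := by rw [hc]; ring
      rw [e]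
      constructor <;> linarith [ht.1, ht.2]
    have h1 := h.eval_eq_sum hjn' ht (natDegree_reflectPoly_le (c := c) hp)
    have h2 := h.eval_eq_sum hjn' ht' hp
    rw [eval_reflectPoly, h2] at h1
    rw [← Equiv.sum_comp Fin.revPerm] at h1
    simp only [Finset.sum_apply, Pi.smul_apply, smul_eq_mul, sub_mul, Finset.sum_sub_distrib,
      Pi.zero_apply]
    rw [← h1, sub_eq_zero]
    refine Finset.sum_congr rfl fun m _ => ?_
    have hm : (m : ℕ) ≤ d := Nat.lt_succ_iff.1 m.2
    have e : ((Fin.revPerm m : Fin (d + 1)) : ℕ) = d - m := by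
      simp [Fin.val_rev]
    rw [e, bspline_reflect hdj hjn ht hm]
  have := Fintype.linearIndependent_iff.1 (h.linearIndependent_bspline hjn') _ key
    ⟨d - m, by omega⟩
  simp only [Nat.sub_sub_self hm] at this
  linarith

end

noncomputable section

/-! ### Symmetric projectors -/

variable {d r n : ℕ} {σ : ℕ → ℕ → ℝ} {P : C(I, ℝ) →L[ℝ] C(I, ℝ)}

-- As `d + 1` is odd, the power is odd about the centre of the support of `B_i`, and equal weights
-- at mirror nodes cancel in pairs.
open Polynomial in
theorem IsQIP.coeffPoly_centre_pow (h : IsQIP d r n σ P) (hs : IsSymmetric d n σ) (hd : Even d)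
    {i : ℕ} (hi : d + r + 1 ≤ i) (hin : i + r ≤ n) :
    coeffPoly n (σ i) ((X - C ((2 * i - d - 1) / (2 * n) : ℝ)) ^ (d + 1)) = 0 := by
  have hn : 0 < n := by omega
  have hn' : (0 : ℝ) < n := by exact_mod_cast hn
  have hi1 : i ∈ Finset.Icc 1 (n + d) := Finset.mem_Icc.2 (by omega)
  have hi2 : i ∈ Finset.Icc (d + 1) n := Finset.mem_Icc.2 (by omega)
  have k1 : knot n ((i : ℤ) - d - 1) = (i - d - 1) / n := by
    rw [knot_eq hn (by omega) (by omega)]; push_cast; ring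
  have k2 : knot n (i : ℤ) = i / n := by rw [knot_eq hn (by omega) (by omega)]; simp
  have hbd : ∀ j ≤ 2 * n, σ i j ≠ 0 → 2 * i ≤ j + 2 * (d + 1 + r) ∧ j ≤ 2 * (i + r) := by
    intro j hj hne
    have := h.is_local i hi1 j hj hne
    rw [k1, k2, ← sub_div, ← add_div, node, ← div_div] at this
    have e1 := (div_le_div_iff_of_pos_right hn').1 this.1
    have e2 := (div_le_div_iff_of_pos_right hn').1 this.2
    constructor
    · have : (2 * i : ℝ) ≤ j + 2 * (d + 1 + r) := by linarith
      exact_mod_cast this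
    · have : (j : ℝ) ≤ 2 * (i + r) := by linarith
      exact_mod_cast this
  rw [coeffPoly_apply]
  -- For nodes of nonzero weight, locality and the bounds on `i` keep the mirror index between `0`
  -- and `2n`; other nodes could be reflected out of range.
  rw [← Finset.sum_filter_of_ne (p := fun j => σ i j ≠ 0) fun j _ hj h0 => hj (by simp [h0])]
  have hsymm : ∀ j ∈ (Finset.range (2 * n + 1)).filter (fun j => σ i j ≠ 0),
      j ≤ 2 * n ∧ j ≤ 2 * (2 * i - d - 1) ∧ 2 * (2 * i - d - 1) - j ≤ 2 * n ∧
      node n j + node n (2 * (2 * i - d - 1) - j) = (2 * i - d - 1) / n ∧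
      σ i (2 * (2 * i - d - 1) - j) = σ i j := by
    intro j hj
    obtain ⟨hj1, hj2⟩ := Finset.mem_filter.1 hj
    have hj3 : j ≤ 2 * n := Nat.lt_succ_iff.1 (Finset.mem_range.1 hj1)
    have := hbd j hj3 hj2
    have hle : j ≤ 2 * (2 * i - d - 1) := by omega
    have hle2 : 2 * (2 * i - d - 1) - j ≤ 2 * n := by omega
    have hnode : node n j + node n (2 * (2 * i - d - 1) - j) = (2 * i - d - 1) / n := by
      have e : ((2 * (2 * i - d - 1) - j : ℕ) : ℝ) = 2 * (2 * i - d - 1) - j := by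
        rw [Nat.cast_sub hle, Nat.cast_mul, Nat.sub_sub, Nat.cast_sub (by omega)]
        push_cast; ring
      rw [node, node, e]
      field_simp
      ring
    refine ⟨hj3, hle, hle2, hnode, (hs.interior i hi2 j hj3 _ hle2 ?_).symm⟩
    rw [hnode, k1, k2]
    ring
  refine Finset.sum_involution (fun j _ => 2 * (2 * i - d - 1) - j) ?_ ?_ ?_ ?_
  · intro j hj
    obtain ⟨-, -, -, h4, h5⟩ := hsymm j hj
    have e : node n (2 * (2 * i - d - 1) - j) - (2 * i - d - 1) / (2 * n)
        = -(node n j - (2 * i - d - 1) / (2 * n)) := by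
      rw [eq_sub_of_add_eq' h4]
      field_simp
      ring
    simp only [eval_pow, eval_sub, eval_X, eval_C]
    rw [h5, e, Odd.neg_pow (by exact hd.add_one)]
    ring
  -- An index fixed by the involution is the centre, where the power vanishes.
  · intro j hj hne heq
    obtain ⟨-, -, -, h4, h5⟩ := hsymm j hj
    rw [heq] at h4
    refine hne ?_
    have : node n j = (2 * i - d - 1) / (2 * n) := by
      rw [← div_div, div_right_comm, ← h4]
      ring
    simp [this]
  · intro j hj
    obtain ⟨h1, h2, h3, -, h5⟩ := hsymm j hj
    refine Finset.mem_filter.2 ⟨Finset.mem_range.2 (by omega), ?_⟩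
    rw [h5]
    exact (Finset.mem_filter.1 hj).2
  · intro j hj
    obtain ⟨-, h2, -⟩ := hsymm j hj
    exact Nat.sub_sub_self h2

open Polynomial in
theorem natDegree_sub_pow_le (d : ℕ) (a b : ℝ) :
    ((X - C a) ^ (d + 1) - (X - C b) ^ (d + 1) : ℝ[X]).natDegree ≤ d := by
  have h1 : ∀ a : ℝ, ((X - C a) ^ (d + 1) : ℝ[X]).degree = (d + 1 : ℕ) := fun a => by
    rw [degree_pow, degree_X_sub_C]; simp
  have h2 : ∀ a : ℝ, ((X - C a) ^ (d + 1) : ℝ[X]).Monic := fun a => (monic_X_sub_C a).pow _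
  have := degree_sub_lt_left ((h1 a).trans (h1 b).symm) (h2 a).ne_zero
    ((h2 a).leadingCoeff.trans (h2 b).leadingCoeff.symm)
  rw [h1 a] at this
  exact natDegree_le_iff_degree_le.2 (Order.le_of_lt_succ this)

-- A functional does not see the power centred at its own spline, at `c₁` or `c₂`. Subtracting that
-- power from `(X - c)^(d+1)` leaves degree at most `d`, where `IsQIP.coeffPoly_reflect` applies;
-- the reflection in `c` changes the sign.
open Polynomial in
theorem IsQIP.coeffPoly_antisymm (h : IsQIP d r n σ P) (hs : IsSymmetric d n σ) (hd : Even d)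
    {j : ℕ} (hdj : d + r ≤ j) (hjn : j + d + 1 + r ≤ n) {m : ℕ} (hm : m ≤ d) :
    coeffPoly n (σ (j + 1 + (d - m))) ((X - C ((2 * j + 1) / (2 * n) : ℝ)) ^ (d + 1))
      = -coeffPoly n (σ (j + 1 + m)) ((X - C ((2 * j + 1) / (2 * n) : ℝ)) ^ (d + 1)) := by
  have hn' : (n : ℝ) ≠ 0 := by exact_mod_cast (by omega : n ≠ 0)
  set c : ℝ := (2 * j + 1) / (2 * n) with hc
  set c₁ : ℝ := (2 * (j + 1 + m : ℕ) - d - 1) / (2 * n) with hc₁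
  set c₂ : ℝ := (2 * (j + 1 + (d - m) : ℕ) - d - 1) / (2 * n) with hc₂
  have z1 := h.coeffPoly_centre_pow hs hd (i := j + 1 + m) (by omega) (by omega)
  have z2 := h.coeffPoly_centre_pow hs hd (i := j + 1 + (d - m)) (by omega) (by omega)
  have hcc : c₂ = (2 * j + 1) / n - c₁ := by
    rw [hc₁, hc₂]
    push_cast [hm]
    field_simp
    ring
  have hrefl : reflectPoly ((2 * j + 1) / n) ((X - C c) ^ (d + 1) - (X - C c₁) ^ (d + 1))
      = -((X - C c) ^ (d + 1) - (X - C c₂) ^ (d + 1)) := by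
    refine Polynomial.funext fun t => ?_
    rw [eval_reflectPoly]
    simp only [eval_sub, eval_pow, eval_X, eval_C, eval_neg]
    have e1 : (2 * j + 1) / n - t - c = -(t - c) := by
      rw [hc]; field_simp; ring
    have e2 : (2 * j + 1) / n - t - c₁ = -(t - c₂) := by rw [hcc]; ring
    rw [e1, e2, Odd.neg_pow hd.add_one, Odd.neg_pow hd.add_one]
    ring
  have := h.coeffPoly_reflect (j := j) (by omega) (by omega) (natDegree_sub_pow_le d c c₁) hm
  rw [hrefl, map_neg, map_sub, map_sub, z1, z2, sub_zero, sub_zero] at this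
  rw [← this, neg_neg]

-- The error for `(t - c)^(d+1)` is odd about the midpoint `c`: the coefficients are antisymmetric
-- and the splines are mirror images of each other.
open Polynomial in
theorem IsQIP.integral_error_pow (h : IsQIP d r n σ P) (hs : IsSymmetric d n σ) (hd : Even d)
    {j : ℕ} (hdj : d + r ≤ j) (hjn : j + d + 1 + r ≤ n) {q : C(I, ℝ)}
    (hq : q = polyC ((X - C ((2 * j + 1) / (2 * n) : ℝ)) ^ (d + 1))) :
    ∫ t in ((j : ℝ) / n)..((j + 1) / n), onReal (P q - q) t = 0 := by
  have hn : (n : ℝ) ≠ 0 := by exact_mod_cast (by omega : n ≠ 0)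
  have hjn' : j + 1 ≤ n := by omega
  have hle : (j : ℝ) / n ≤ (j + 1) / n := by gcongr; linarith
  have hanti : ∀ t ∈ Ioo ((j : ℝ) / n) ((j + 1) / n),
      onReal (P q - q) ((2 * j + 1) / n - t) = -onReal (P q - q) t := by
    intro t ht
    have ht' : (2 * j + 1) / n - t ∈ Ioo ((j : ℝ) / n) ((j + 1) / n) := by
      have e : (2 * j + 1 : ℝ) / n = j / n + (j + 1) / n := by ring
      rw [e]
      constructor <;> linarith [ht.1, ht.2]
    rw [onReal_apply _ (Ioo_subset_unit hjn' ht), onReal_apply _ (Ioo_subset_unit hjn' ht'),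
      ContinuousMap.sub_apply, ContinuousMap.sub_apply, h.repr_interval hjn' ht,
      h.repr_interval hjn' ht', hq]
    simp only [coeffFunctional_polyC, polyC_apply, eval_pow, eval_sub, eval_X, eval_C]
    have e1 : (2 * j + 1) / n - t - (2 * j + 1) / (2 * n) = -(t - (2 * j + 1) / (2 * n)) := by
      field_simp; ring
    rw [e1, Odd.neg_pow hd.add_one, neg_sub, sub_neg_eq_add,
      ← Equiv.sum_comp Fin.revPerm,
      add_comm, sub_eq_add_neg _ (Finset.sum _ _), add_right_inj, ← Finset.sum_neg_distrib]
    refine Finset.sum_congr rfl fun m _ => ?_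
    have hm : (m : ℕ) ≤ d := Nat.lt_succ_iff.1 m.2
    have e : ((Fin.revPerm m : Fin (d + 1)) : ℕ) = d - m := by
      simp [Fin.val_rev]
    rw [e, bspline_reflect (by omega) (by omega) ht hm, h.coeffPoly_antisymm hs hd hdj hjn hm]
    ring
  have h1 := intervalIntegral.integral_congr_Ioo_of_le (μ := volume) hle hanti
  have h2 := intervalIntegral.integral_comp_sub_left (a := (j : ℝ) / n) (b := (j + 1) / n)
    (fun t => onReal (P q - q) t) ((2 * j + 1) / n)
  rw [show (2 * j + 1 : ℝ) / n - (j + 1) / n = j / n by ring,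
    show (2 * j + 1 : ℝ) / n - j / n = (j + 1) / n by ring] at h2
  rw [h2, intervalIntegral.integral_neg] at h1
  linarith

/-- For even `d` and symmetric coefficients, the error integrates over an interior knot interval
to one order more than its size suggests. -/
theorem IsQIP.integral_error_interval (h : IsQIP d r n σ P) (hs : IsSymmetric d n σ)
    (hd : Even d) {x : C(I, ℝ)} {X : ℕ → ℝ → ℝ} (hX : IsDerivChain (d + 1) X)
    (hx : ∀ t : I, x t = X 0 t) {M : ℝ} (hM0 : 0 ≤ M)
    (hM : ∀ s ∈ Icc (0 : ℝ) 1, ∀ t ∈ Icc (0 : ℝ) 1, |X (d + 1) s - X (d + 1) t| ≤ M * |s - t|)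
    {j : ℕ} (hdj : d + r ≤ j) (hjn : j + d + 1 + r ≤ n) :
    |∫ t in ((j : ℝ) / n)..((j + 1) / n), onReal (P x - x) t|
      ≤ (‖P‖ + 1) * (M * ((d + r + 2) / n) ^ (d + 2)) * (1 / n) := by
  have hn : (0 : ℝ) < n := by exact_mod_cast (by omega : 0 < n)
  have hjn' : j + 1 ≤ n := by omega
  have hle : (j : ℝ) / n ≤ (j + 1) / n := by gcongr; linarith
  set c : ℝ := (2 * j + 1) / (2 * n) with hc
  have hcm : c ∈ Ioo ((j : ℝ) / n) ((j + 1) / n) := by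
    rw [hc]
    constructor
    · rw [div_lt_div_iff₀ hn (by positivity)]; nlinarith
    · rw [div_lt_div_iff₀ (by positivity) hn]; nlinarith
  set p : Polynomial ℝ := taylorPoly X (d + 1) c with hp
  set β : ℝ := X (d + 1) c / (d + 1).factorial with hβ
  set q : C(I, ℝ) := polyC ((Polynomial.X - Polynomial.C c) ^ (d + 1)) with hq
  -- The part `p` is reproduced and the error of `q` has zero integral, so only a Taylor remainder
  -- of order `d + 2` matters.
  set y : C(I, ℝ) := x - polyC p - β • q with hy
  have hT : ∀ t : I, y t = X 0 t - (taylorPoly X (d + 1 + 1) c).eval (t : ℝ) := by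
    intro t
    rw [taylorPoly, Finset.sum_range_succ, Polynomial.eval_add, ← taylorPoly, ← hp, hy]
    simp only [ContinuousMap.sub_apply, ContinuousMap.smul_apply, hx, polyC_apply, hq, hβ,
      smul_eq_mul, Polynomial.eval_mul, Polynomial.eval_C]
    ring
  have hdec : P x - x = (P y - y) + β • (P q - q) := by
    rw [hy, map_sub, map_sub, map_smul,
      h.proj _ (isSpline_polyC (natDegree_taylorPoly X d c))]
    module
  have hdec' : ∀ t, onReal (P x - x) t = onReal (P y - y) t + β * onReal (P q - q) t := by
    intro t
    rw [hdec]
    rfl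
  simp only [hdec']
  rw [intervalIntegral.integral_add ((continuous_onReal _).intervalIntegrable _ _)
    (((continuous_onReal _).const_mul _).intervalIntegrable _ _),
    intervalIntegral.integral_const_mul, h.integral_error_pow hs hd hdj hjn hq, mul_zero,
    add_zero]
  have hlen : |((j + 1 : ℝ)) / n - j / n| = 1 / n := by
    rw [← sub_div, add_sub_cancel_left, abs_of_nonneg (by positivity)]
  rw [← hlen, ← Real.norm_eq_abs]
  refine intervalIntegral.norm_integral_le_of_norm_le_const_ae ?_
  have hae : ∀ᵐ t : ℝ, t ≠ (j + 1) / n := by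
    simp [ae_iff]
  filter_upwards [hae] with t hne ht
  rw [uIoc_of_le hle] at ht
  have ht : t ∈ Ioo ((j : ℝ) / n) ((j + 1) / n) := ⟨ht.1, lt_of_le_of_ne ht.2 hne⟩
  rw [onReal_apply _ (Ioo_subset_unit hjn' ht), Real.norm_eq_abs]
  refine h.local_error (p := 0) (by positivity) (by simp) fun s hs' => ?_
  rw [hT, Polynomial.eval_zero, sub_zero]
  refine (hX.taylor_bound hM c (Ioo_subset_unit hjn' hcm) s s.2).trans ?_
  -- The reach `(d + r + 1) / n` of `P` around `t`, plus one interval length between `t` and `c`.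
  have : |(s : ℝ) - c| ≤ (d + r + 2) / n := by
    have e1 : ((d : ℝ) + r + 2) / n = (d + r + 1) / n + ((j + 1) / n - j / n) := by ring
    have hs'' := abs_le.1 hs'
    simp only at hs''
    rw [e1, abs_le]
    constructor <;> linarith [ht.1, ht.2, hcm.1, hcm.2]
  gcongr

/-! ### Superconvergence in a weak norm -/

/-- If `e` is of size `E h^(d+1)`, and its integrals over all knot intervals but boundedly many at
the ends are of size `E' h^(d+3)`, then its integrals against Lipschitz functions are of order
`d + 2`. -/
theorem abs_integral_mul_le {g e : ℝ → ℝ} (hg : ContinuousOn g (Icc 0 1))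
    (he : ContinuousOn e (Icc 0 1)) {G Λ E E' : ℝ} {D d n : ℕ} (hn : 0 < n) (hE' : 0 ≤ E')
    (hgG : ∀ s ∈ Icc (0 : ℝ) 1, |g s| ≤ G)
    (hgΛ : ∀ s ∈ Icc (0 : ℝ) 1, ∀ t ∈ Icc (0 : ℝ) 1, |g s - g t| ≤ Λ * |s - t|)
    (heE : ∀ s ∈ Icc (0 : ℝ) 1, |e s| ≤ E * (1 / n) ^ (d + 1))
    (hint : ∀ j : ℕ, D ≤ j → j + D + 1 ≤ n →
      |∫ t in ((j : ℝ) / n)..((j + 1) / n), e t| ≤ E' * (1 / n) ^ (d + 3)) :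
    |∫ t in (0 : ℝ)..1, g t * e t| ≤ (G * E' + Λ * E + 2 * D * (G * E)) * (1 / n) ^ (d + 2) := by
  have hn' : (0 : ℝ) < n := by exact_mod_cast hn
  have h0 : (0 : ℝ) ∈ Icc (0 : ℝ) 1 := by simp
  have h1 : (1 : ℝ) ∈ Icc (0 : ℝ) 1 := by simp
  have hG : 0 ≤ G := (abs_nonneg _).trans (hgG 0 h0)
  have hΛ : 0 ≤ Λ := by simpa using (abs_nonneg _).trans (hgΛ 0 h0 1 h1)
  have hE : 0 ≤ E := by
    have := (abs_nonneg _).trans (heE 0 h0)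
    exact nonneg_of_mul_nonneg_left this (by positivity)
  set η : ℝ := 1 / n with hη
  have hη0 : 0 < η := by positivity
  have hnη : n * η = 1 := by rw [hη]; field_simp
  have hsub : ∀ j < n, Icc ((j : ℝ) / n) ((j + 1) / n) ⊆ Icc 0 1 := by
    intro j hj
    have : ((j : ℝ) + 1) ≤ n := by exact_mod_cast hj
    exact Icc_subset_Icc (by positivity) (div_le_one_of_le₀ this hn'.le)
  have hle : ∀ j : ℕ, (j : ℝ) / n ≤ (j + 1) / n := fun j => by gcongr; linarith
  have hlen : ∀ j : ℕ, |((j + 1 : ℝ)) / n - j / n| = η := fun j => by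
    rw [← sub_div, add_sub_cancel_left, abs_of_nonneg (by positivity)]
  have hsum : ∫ t in (0 : ℝ)..1, g t * e t
      = ∑ j ∈ Finset.range n, ∫ t in ((j : ℝ) / n)..((j + 1) / n), g t * e t := by
    have := intervalIntegral.sum_integral_adjacent_intervals (f := fun t => g t * e t)
      (μ := volume) (a := fun j : ℕ => (j : ℝ) / n) (n := n) (fun j hj => by
        push_cast
        exact ((hg.mul he).mono (hsub j hj)).intervalIntegrable_of_Icc (hle j))
    push_cast at this
    rw [this, zero_div, div_self hn'.ne']
  have hcrude : ∀ j < n, |∫ t in ((j : ℝ) / n)..((j + 1) / n), g t * e t|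
      ≤ G * E * η ^ (d + 2) := by
    intro j hj
    have : |∫ t in ((j : ℝ) / n)..((j + 1) / n), g t * e t| ≤ G * (E * η ^ (d + 1)) * η := by
      rw [← hlen j, ← Real.norm_eq_abs]
      refine intervalIntegral.norm_integral_le_of_norm_le_const fun t ht => ?_
      rw [uIoc_of_le (hle j)] at ht
      have ht' := hsub j hj (Ioc_subset_Icc_self ht)
      rw [norm_mul, hlen j]
      exact mul_le_mul (hgG t ht') (heE t ht') (norm_nonneg _) hG
    exact this.trans_eq (by ring)
  have hfine : ∀ j : ℕ, D ≤ j → j + D + 1 ≤ n →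
      |∫ t in ((j : ℝ) / n)..((j + 1) / n), g t * e t|
        ≤ (G * E' + Λ * E) * η ^ (d + 3) := by
    intro j hj1 hj2
    have hj : j < n := by omega
    have hjm : (j : ℝ) / n ∈ Icc (0 : ℝ) 1 := hsub j hj (left_mem_Icc.2 (hle j))
    have hci := (he.mono (hsub j hj)).intervalIntegrable_of_Icc (μ := volume) (hle j)
    have hgi : IntervalIntegrable (fun t => (g t - g (j / n)) * e t) volume
        ((j : ℝ) / n) ((j + 1) / n) :=
      (((hg.sub continuousOn_const).mul he).mono (hsub j hj)).intervalIntegrable_of_Icc (hle j)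
    -- With `g` frozen at the left end, the small integral of `e` enters; the variation of `g`
    -- supplies a factor `η` in the rest.
    have e1 : ∫ t in ((j : ℝ) / n)..((j + 1) / n), g t * e t
        = g (j / n) * (∫ t in ((j : ℝ) / n)..((j + 1) / n), e t)
          + ∫ t in ((j : ℝ) / n)..((j + 1) / n), (g t - g (j / n)) * e t := by
      rw [← intervalIntegral.integral_const_mul,
        ← intervalIntegral.integral_add (hci.const_mul _) hgi]
      congr 1
      ext t
      ring
    have e2 : |∫ t in ((j : ℝ) / n)..((j + 1) / n), (g t - g (j / n)) * e t|
        ≤ (Λ * η) * (E * η ^ (d + 1)) * η := by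
      rw [← hlen j, ← Real.norm_eq_abs]
      refine intervalIntegral.norm_integral_le_of_norm_le_const fun t ht => ?_
      rw [uIoc_of_le (hle j)] at ht
      have ht' := hsub j hj (Ioc_subset_Icc_self ht)
      rw [norm_mul, hlen j]
      refine mul_le_mul ((hgΛ t ht' _ hjm).trans ?_) (heE t ht') (norm_nonneg _) (by positivity)
      refine mul_le_mul_of_nonneg_left ?_ hΛ
      rw [← hlen j]
      rw [abs_of_nonneg (by linarith [ht.1]), abs_of_nonneg (by linarith [hle j])]
      linarith [ht.2]
    rw [e1]
    calc _ ≤ |g (j / n)| * |∫ t in ((j : ℝ) / n)..((j + 1) / n), e t|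
          + |∫ t in ((j : ℝ) / n)..((j + 1) / n), (g t - g (j / n)) * e t| := by
            rw [← abs_mul]; exact abs_add_le _ _
      _ ≤ G * (E' * η ^ (d + 3)) + (Λ * η) * (E * η ^ (d + 1)) * η := by
            gcongr
            · exact hgG _ hjm
            · exact hint j hj1 hj2
      _ = _ := by ring
  rw [hsum]
  refine (Finset.abs_sum_le_sum_abs _ _).trans ?_
  -- The first and last `D` intervals have only the bound of order `η^(d+2)`, affordable since there
  -- are at most `2 D` of them. The others number up to `n` and need `η^(d+3)`.
  have hterm : ∀ j ∈ Finset.range n, |∫ t in ((j : ℝ) / n)..((j + 1) / n), g t * e t|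
      ≤ (G * E' + Λ * E) * η ^ (d + 3) + ((if j < D then G * E * η ^ (d + 2) else 0)
        + (if n - D ≤ j then G * E * η ^ (d + 2) else 0)) := by
    intro j hj
    rw [Finset.mem_range] at hj
    have p1 : 0 ≤ (G * E' + Λ * E) * η ^ (d + 3) := by positivity
    have p2 : 0 ≤ G * E * η ^ (d + 2) := by positivity
    have := hcrude j hj
    by_cases c1 : j < D
    · rw [if_pos c1]
      split_ifs <;> linarith
    by_cases c2 : n - D ≤ j
    · rw [if_neg c1, if_pos c2]
      linarith
    rw [if_neg c1, if_neg c2, add_zero, add_zero]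
    exact hfine j (by omega) (by omega)
  refine (Finset.sum_le_sum hterm).trans ?_
  rw [Finset.sum_add_distrib, Finset.sum_add_distrib, Finset.sum_const, Finset.card_range,
    ← Finset.sum_filter, ← Finset.sum_filter, Finset.sum_const, Finset.sum_const, nsmul_eq_mul,
    nsmul_eq_mul, nsmul_eq_mul]
  have c1 : ((Finset.range n).filter (fun j => j < D)).card ≤ D := by
    refine (Finset.card_le_card (t := Finset.range D) fun j hj => ?_).trans (by simp)
    exact Finset.mem_range.2 (Finset.mem_filter.1 hj).2
  have c2 : ((Finset.range n).filter (fun j => n - D ≤ j)).card ≤ D := by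
    refine (Finset.card_le_card (t := Finset.Ico (n - D) n) fun j hj => ?_).trans
      (by rw [Nat.card_Ico]; omega)
    have := Finset.mem_filter.1 hj
    exact Finset.mem_Ico.2 ⟨this.2, Finset.mem_range.1 this.1⟩
  have c1' : (((Finset.range n).filter (fun j => j < D)).card : ℝ) ≤ D := by exact_mod_cast c1
  have c2' : (((Finset.range n).filter (fun j => n - D ≤ j)).card : ℝ) ≤ D := by
    exact_mod_cast c2
  calc _ ≤ n * ((G * E' + Λ * E) * η ^ (d + 3)) + (D * (G * E * η ^ (d + 2))
        + D * (G * E * η ^ (d + 2))) := by gcongr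
    _ = (n * η) * ((G * E' + Λ * E) * η ^ (d + 2)) + 2 * D * (G * E) * η ^ (d + 2) := by ring
    _ = _ := by rw [hnη]; ring

end

noncomputable section

/-! ### Linear integral operators -/

theorem abs_integral_unit_le {F : I → ℝ} {C : ℝ} (h : ∀ t, |F t| ≤ C) : |∫ t : I, F t| ≤ C := by
  have := norm_integral_le_of_norm_le_const (μ := (volume : Measure I)) (f := F) (C := C)
    (Eventually.of_forall h)
  simpa using this

theorem integrable_unit {F : I → ℝ} (h : Continuous F) : Integrable F :=
  h.integrable_of_hasCompactSupport (HasCompactSupport.of_compactSpace F)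

theorem integral_unit_eq (F : ℝ → ℝ) : ∫ t : I, F t = ∫ t in (0 : ℝ)..1, F t := by
  rw [intervalIntegral.integral_of_le zero_le_one, ← integral_Icc_eq_integral_Ioc]
  exact integral_subtype measurableSet_Icc F

/-- The integral operator `v ↦ ∫₀¹ κ(·, t) v(t) dt`. -/
def kernelOp (κ : C(I × I, ℝ)) : C(I, ℝ) →L[ℝ] C(I, ℝ) :=
  LinearMap.mkContinuous
    { toFun := fun v =>
        { toFun := fun s => ∫ t : I, κ (s, t) * v t
          continuous_toFun := by
            have h := continuous_parametric_integral_of_continuous (μ := (volume : Measure I))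
              (f := fun s t : I => κ (s, t) * v t) (by fun_prop) isCompact_univ
            simpa only [Measure.restrict_univ] using h }
      map_add' := fun v w => by
        ext s
        simp only [ContinuousMap.coe_mk, ContinuousMap.add_apply, mul_add]
        exact integral_add (integrable_unit (by fun_prop)) (integrable_unit (by fun_prop))
      map_smul' := fun c v => by
        ext s
        simp only [ContinuousMap.coe_mk, ContinuousMap.smul_apply, smul_eq_mul, RingHom.id_apply,
          mul_left_comm _ c]
        exact integral_const_mul c _ }
    ‖κ‖ fun v => by
      rw [ContinuousMap.norm_le _ (by positivity)]
      intro s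
      refine abs_integral_unit_le fun t => ?_
      rw [abs_mul]
      exact mul_le_mul (κ.norm_coe_le_norm _) (v.norm_coe_le_norm _) (abs_nonneg _)
        (norm_nonneg _)

theorem kernelOp_apply (κ : C(I × I, ℝ)) (v : C(I, ℝ)) (s : I) :
    kernelOp κ v s = ∫ t : I, κ (s, t) * v t := rfl

theorem kernelOp_lipschitz {κ : C(I × I, ℝ)} {Λ : ℝ}
    (hκ : ∀ s s' t : I, |κ (s, t) - κ (s', t)| ≤ Λ * |(s : ℝ) - s'|) (v : C(I, ℝ)) (s s' : I) :
    |kernelOp κ v s - kernelOp κ v s'| ≤ Λ * ‖v‖ * |(s : ℝ) - s'| := by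
  rw [kernelOp_apply, kernelOp_apply,
    ← integral_sub (integrable_unit (by fun_prop)) (integrable_unit (by fun_prop))]
  refine abs_integral_unit_le fun t => ?_
  rw [← sub_mul, abs_mul]
  calc _ ≤ Λ * |(s : ℝ) - s'| * ‖v‖ :=
        mul_le_mul (hκ s s' t) (v.norm_coe_le_norm t) (abs_nonneg _)
          ((abs_nonneg _).trans (hκ s s' t))
    _ = _ := by ring

/-- Arzelà–Ascoli. The Lipschitz condition is closed pointwise and forces continuity, so the image
in `I → ℝ` is a closed subset of a compact product. -/
theorem isCompact_lipschitz_ball (A Λ : ℝ) :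
    IsCompact {g : C(I, ℝ) | (∀ s, |g s| ≤ A) ∧
      ∀ s s' : I, |g s - g s'| ≤ Λ * |(s : ℝ) - s'|} := by
  apply ArzelaAscoli.isCompact_of_equicontinuous
  · have heq : ContinuousMap.toFun '' {g : C(I, ℝ) | (∀ s, |g s| ≤ A) ∧
        ∀ s s' : I, |g s - g s'| ≤ Λ * |(s : ℝ) - s'|}
        = (univ.pi fun _ : I => Icc (-A) A) ∩
          {g : I → ℝ | ∀ s s' : I, |g s - g s'| ≤ Λ * |(s : ℝ) - s'|} := by
      ext g
      constructor
      · rintro ⟨g, hg, rfl⟩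
        exact ⟨fun s _ => abs_le.1 (hg.1 s), hg.2⟩
      · rintro ⟨h1, h2⟩
        have hc : Continuous g := by
          refine (LipschitzWith.of_dist_le_mul (K := Λ.toNNReal) fun s s' => ?_).continuous
          refine (h2 s s').trans ?_
          rw [Subtype.dist_eq, Real.dist_eq]
          gcongr
          exact Real.le_coe_toNNReal Λ
        exact ⟨⟨g, hc⟩, ⟨fun s => abs_le.2 (h1 s (mem_univ s)), h2⟩, rfl⟩
    rw [heq]
    refine (isCompact_univ_pi fun _ => isCompact_Icc).inter_right ?_
    simp only [ofPred_forall]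
    refine isClosed_iInter fun s => isClosed_iInter fun s' => ?_
    exact isClosed_le (by fun_prop) continuous_const
  · refine Metric.equicontinuous_of_continuity_modulus (fun x => Λ * x) ?_ _ ?_
    · have : Continuous fun x : ℝ => Λ * x := by fun_prop
      simpa using this.tendsto 0
    · intro s s' g
      rw [Real.dist_eq, Subtype.dist_eq, Real.dist_eq]
      exact g.2.2 s s'

/-- Images of the unit ball inherit the Lipschitz constant of the kernel in `s`. -/
theorem isCompactOperator_kernelOp {κ : C(I × I, ℝ)} {Λ : ℝ} (hΛ : 0 ≤ Λ)
    (hκ : ∀ s s' t : I, |κ (s, t) - κ (s', t)| ≤ Λ * |(s : ℝ) - s'|) :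
    IsCompactOperator (kernelOp κ) := by
  refine ⟨_, isCompact_lipschitz_ball ‖kernelOp κ‖ Λ,
    mem_of_superset (Metric.closedBall_mem_nhds 0 one_pos) fun v hv => ?_⟩
  have hv : ‖v‖ ≤ 1 := by simpa using hv
  refine ⟨fun s => ?_, fun s s' => (kernelOp_lipschitz hκ v s s').trans ?_⟩
  · refine ((kernelOp κ v).norm_coe_le_norm s).trans (((kernelOp κ).le_opNorm v).trans ?_)
    exact mul_le_of_le_one_right (norm_nonneg _) hv
  · gcongr
    exact mul_le_of_le_one_right hΛ hv

/-- The Fredholm alternative, in terms of a two-sided inverse of `1 - L`. -/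
theorem exists_inverse_of_not_hasEigenvalue {E : Type*} [NormedAddCommGroup E] [NormedSpace ℝ E]
    [CompleteSpace E] {L : E →L[ℝ] E} (hL : IsCompactOperator L)
    (h : ¬ Module.End.HasEigenvalue (L : E →ₗ[ℝ] E) 1) :
    ∃ R : E →L[ℝ] E, (∀ x, R (x - L x) = x) ∧ ∀ x, R x - L (R x) = x := by
  have := (hL.hasEigenvalue_or_mem_resolventSet one_ne_zero).resolve_left h
  rw [spectrum.mem_resolventSet_iff, map_one] at this
  obtain ⟨u, hu⟩ := this
  refine ⟨(u⁻¹ : (E →L[ℝ] E)ˣ), fun x => ?_, fun x => ?_⟩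
  · have h1 : ((u⁻¹ : (E →L[ℝ] E)ˣ) : E →L[ℝ] E) * (1 - L) = 1 := by rw [← hu]; exact u.inv_mul
    exact DFunLike.congr_fun h1 x
  · have h1 : (1 - L) * ((u⁻¹ : (E →L[ℝ] E)ˣ) : E →L[ℝ] E) = 1 := by rw [← hu]; exact u.mul_inv
    exact DFunLike.congr_fun h1 x

/-! ### Perturbed fixed-point equations -/

section FixedPoint

variable {E : Type*} [NormedAddCommGroup E] [NormedSpace ℝ E] {K T : E → E} {L R : E →L[ℝ] E}
  {φ f : E} {δ : ℝ}

/-- Applying `R` to the difference of the two equations gives `ψ - φ = R (T ψ - T φ - L (ψ - φ)) + R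
(T φ - K φ)`; the first term is at most half of the left side and is absorbed. -/
theorem norm_sub_le_of_approx (hR : ∀ x, R (x - L x) = x) (hφ : φ - K φ = f) (hδ : 0 < δ)
    (hT : ∀ x ∈ Metric.ball φ δ, ∀ y ∈ Metric.ball φ δ,
      ‖R‖ * ‖T x - T y - L (x - y)‖ ≤ 1 / 2 * ‖x - y‖)
    {ψ : E} (hψ : ψ ∈ Metric.ball φ δ) (hψf : ψ - T ψ = f) :
    ‖ψ - φ‖ ≤ 2 * ‖R‖ * ‖T φ - K φ‖ := by
  have e : ψ - φ = R (T ψ - T φ - L (ψ - φ)) + R (T φ - K φ) := by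
    rw [← map_add, ← hR (ψ - φ)]
    congr 1
    rw [hR]
    have : ψ - φ = T ψ - K φ := by
      rw [← sub_eq_zero, ← sub_eq_zero.2 (hψf.trans hφ.symm)]
      abel
    rw [this]
    abel
  have h1 := hT ψ hψ φ (Metric.mem_ball_self hδ)
  have h2 := R.le_opNorm (T ψ - T φ - L (ψ - φ))
  have h3 := R.le_opNorm (T φ - K φ)
  have h4 : ‖ψ - φ‖ ≤ ‖R (T ψ - T φ - L (ψ - φ))‖ + ‖R (T φ - K φ)‖ := by
    conv_lhs => rw [e]
    exact norm_add_le _ _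
  linarith

/-- The equation is equivalent to `x = R (f + T x - L x)`, whose right side contracts distances in
the ball by `1 / 2`. -/
theorem existsUnique_of_approx [CompleteSpace E] (hR : ∀ x, R (x - L x) = x)
    (hR' : ∀ x, R x - L (R x) = x) (hφ : φ - K φ = f) (hδ : 0 < δ)
    (hT : ∀ x ∈ Metric.ball φ δ, ∀ y ∈ Metric.ball φ δ,
      ‖R‖ * ‖T x - T y - L (x - y)‖ ≤ 1 / 2 * ‖x - y‖)
    (hres : ‖R‖ * ‖T φ - K φ‖ ≤ δ / 4) :
    ∃! ψ, ψ ∈ Metric.ball φ δ ∧ ψ - T ψ = f := by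
  set F : E → E := fun x => R (f + T x - L x) with hF
  have hFsub : ∀ x y, F x - F y = R (T x - T y - L (x - y)) := by
    intro x y
    rw [hF]
    beta_reduce
    rw [← map_sub, map_sub L]
    congr 1
    abel
  have hFφ : F φ - φ = R (T φ - K φ) := by
    have : F φ - φ = R (f + T φ - L φ) - R (φ - L φ) := by rw [hR φ]
    rw [this, ← map_sub, ← hφ]
    congr 1
    abel
  have hfix : ∀ x, F x = x → x - T x = f := by
    intro x hx
    have h1 := hR' (f + T x - L x)
    have h2 : R (f + T x - L x) = x := hx
    rw [h2] at h1
    have h3 : x = f + T x := sub_left_injective h1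
    rw [sub_eq_iff_eq_add]
    exact h3
  have hlip : ∀ x ∈ Metric.ball φ δ, ∀ y ∈ Metric.ball φ δ, ‖F x - F y‖ ≤ 1 / 2 * ‖x - y‖ := by
    intro x hx y hy
    rw [hFsub]
    exact (R.le_opNorm _).trans (hT x hx y hy)
  have hsub : Metric.closedBall φ (δ / 2) ⊆ Metric.ball φ δ :=
    Metric.closedBall_subset_ball (by linarith)
  -- `F φ` is within `δ / 4` of `φ`, and contraction from radius `δ / 2` adds another `δ / 4`.
  have hmaps : MapsTo F (Metric.closedBall φ (δ / 2)) (Metric.closedBall φ (δ / 2)) := by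
    intro x hx
    have h1 := hlip x (hsub hx) φ (Metric.mem_ball_self hδ)
    have h2 := R.le_opNorm (T φ - K φ)
    rw [← hFφ] at h2
    rw [mem_closedBall_iff_norm] at hx ⊢
    calc ‖F x - φ‖ = ‖(F x - F φ) + (F φ - φ)‖ := by congr 1; abel
      _ ≤ ‖F x - F φ‖ + ‖F φ - φ‖ := norm_add_le _ _
      _ ≤ _ := by linarith
  have hcontr : ContractingWith (1 / 2) (hmaps.restrict F _ _) := by
    refine ⟨by rw [← NNReal.coe_lt_coe]; norm_num, LipschitzWith.of_dist_le_mul fun x y => ?_⟩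
    rw [Subtype.dist_eq, Subtype.dist_eq, dist_eq_norm, dist_eq_norm]
    simpa using hlip x (hsub x.2) y (hsub y.2)
  obtain ⟨ψ, hψ, hψF, -⟩ := hcontr.exists_fixedPoint' (Metric.isClosed_closedBall.isComplete)
    hmaps (Metric.mem_closedBall_self (by linarith)) (edist_ne_top φ (F φ))
  refine ⟨ψ, ⟨hsub hψ, hfix ψ hψF⟩, ?_⟩
  rintro y ⟨hy, hyf⟩
  have hyF : F y = y := by
    have : f + T y - L y = y - L y := by rw [← hyf]; abel
    rw [hF]
    beta_reduce
    rw [this, hR]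
  have h1 := hlip y hy ψ (hsub hψ)
  rw [hyF, hψF.eq] at h1
  have : ‖y - ψ‖ = 0 := le_antisymm (by linarith) (norm_nonneg _)
  exact sub_eq_zero.1 (norm_eq_zero.1 this)

/-- Solvability of the modified projection equation near an isolated solution, for operators with a
first-order expansion around that solution. -/
theorem exists_solution_modified [CompleteSpace E] (hR : ∀ x, R (x - L x) = x)
    (hR' : ∀ x, R x - L (R x) = x) (hφ : φ - K φ = f) {Λ ε₀ C : ℝ} (hΛ : 0 ≤ Λ) (hε₀ : 0 < ε₀)
    (hC : 0 ≤ C)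
    (hK : ∀ x y, ‖x - φ‖ ≤ ε₀ → ‖y - φ‖ ≤ ε₀ →
      ‖K x - K y - L (x - y)‖ ≤ Λ * (‖x - φ‖ + ‖y - φ‖) * ‖x - y‖)
    {P : ℕ → E →L[ℝ] E} (hP : ∀ᶠ n in atTop, ‖P n‖ ≤ C)
    {ε : ℕ → ℝ} (hε : Tendsto ε atTop (𝓝 0))
    (hPL : ∀ᶠ n in atTop, ∀ v, ‖P n (L v) - L v‖ ≤ ε n * ‖v‖)
    (hPφ : Tendsto (fun n => ‖P n φ - φ‖) atTop (𝓝 0)) {T : ℕ → E → E}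
    (hT : ∀ n x, T n x = P n (K x) + K (P n x) - P n (K (P n x)))
    (hres : Tendsto (fun n => ‖T n φ - K φ‖) atTop (𝓝 0)) :
    ∃ δ : ℝ, 0 < δ ∧ (∀ᶠ n in atTop, ∃! ψ, ψ ∈ Metric.ball φ δ ∧ ψ - T n ψ = f) ∧
      ∀ᶠ n in atTop, ∀ ψ ∈ Metric.ball φ δ, ψ - T n ψ = f →
        ‖ψ - φ‖ ≤ 2 * ‖R‖ * ‖T n φ - K φ‖ := by
  -- The contraction constant will be `Q δ + ‖R‖ (1 + C) ε n`. The choice of `δ` makes `Q δ ≤ 1 /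
  -- 4`, large `n` does the same for the other term, and `(C + 1) δ ≤ ε₀` keeps `P n z` where the
  -- expansion of `K` holds.
  set Q : ℝ := ‖R‖ * (2 * C * Λ + 2 * (1 + C) * (1 + C) * Λ * C) with hQ
  have hQ0 : 0 ≤ Q := by positivity
  set δ : ℝ := min (ε₀ / (C + 1)) (1 / (4 * (Q + 1))) with hδ
  have hδ0 : 0 < δ := by positivity
  have hδ1 : (C + 1) * δ ≤ ε₀ := by
    have : δ ≤ ε₀ / (C + 1) := min_le_left _ _
    rwa [le_div_iff₀ (by positivity), mul_comm] at this
  have hδ2 : Q * δ ≤ 1 / 4 := by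
    have : δ ≤ 1 / (4 * (Q + 1)) := min_le_right _ _
    rw [le_div_iff₀ (by positivity)] at this
    linarith
  have hδ3 : δ ≤ ε₀ := by nlinarith
  have hεs : ∀ᶠ n in atTop, ‖R‖ * (1 + C) * ε n ≤ 1 / 4 := by
    have : Tendsto (fun n => ‖R‖ * (1 + C) * ε n) atTop (𝓝 0) := by
      simpa using hε.const_mul (‖R‖ * (1 + C))
    exact this.eventually_le_const (by norm_num)
  have hPφs : ∀ᶠ n in atTop, ‖P n φ - φ‖ ≤ δ := hPφ.eventually_le_const hδ0
  have hress : ∀ᶠ n in atTop, ‖R‖ * ‖T n φ - K φ‖ ≤ δ / 4 := by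
    have : Tendsto (fun n => ‖R‖ * ‖T n φ - K φ‖) atTop (𝓝 0) := by
      simpa using hres.const_mul ‖R‖
    exact this.eventually_le_const (by linarith)
  have hcontr : ∀ᶠ n in atTop, ∀ x ∈ Metric.ball φ δ, ∀ y ∈ Metric.ball φ δ,
      ‖R‖ * ‖T n x - T n y - L (x - y)‖ ≤ 1 / 2 * ‖x - y‖ := by
    filter_upwards [hP, hPL, hεs, hPφs] with n h1 h2 h3 h4 x hx y hy
    rw [mem_ball_iff_norm] at hx hy
    have hPn : ∀ v, ‖P n v‖ ≤ C * ‖v‖ := fun v =>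
      ((P n).le_opNorm v).trans (by gcongr)
    have hPball : ∀ z, ‖z - φ‖ < δ → ‖P n z - φ‖ ≤ (1 + C) * δ := by
      intro z hz
      calc ‖P n z - φ‖ = ‖P n (z - φ) + (P n φ - φ)‖ := by rw [map_sub]; congr 1; abel
        _ ≤ ‖P n (z - φ)‖ + ‖P n φ - φ‖ := norm_add_le _ _
        _ ≤ C * δ + δ := by
            gcongr
            exact (hPn _).trans (by gcongr)
        _ = _ := by ring
    set D : ℝ := ‖x - y‖ with hD
    have hD0 : 0 ≤ D := norm_nonneg _
    have hKxy : ‖K x - K y - L (x - y)‖ ≤ Λ * (δ + δ) * D :=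
      (hK x y (hx.le.trans hδ3) (hy.le.trans hδ3)).trans (by gcongr)
    have hPxy : ‖P n x - P n y‖ ≤ C * D := by rw [← map_sub]; exact hPn _
    have hKP : ‖K (P n x) - K (P n y) - L (P n x - P n y)‖
        ≤ Λ * ((1 + C) * δ + (1 + C) * δ) * (C * D) := by
      have hx' := hPball x hx
      have hy' := hPball y hy
      refine (hK _ _ (hx'.trans (by linarith)) (hy'.trans (by linarith))).trans ?_
      gcongr
    have hL1 : ‖P n (L (x - y)) - L (x - y)‖ ≤ ε n * D := h2 _
    have hεD : 0 ≤ ε n * D := (norm_nonneg _).trans hL1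
    have hL2 : ‖P n (L (P n x - P n y)) - L (P n x - P n y)‖ ≤ C * (ε n * D) := by
      -- The bound `hL1` forces `ε n ≥ 0` only if `D > 0`.
      rcases hD0.eq_or_lt with h0 | h0
      · have : P n x - P n y = 0 := by
          rw [← norm_eq_zero]
          exact le_antisymm (hPxy.trans (by rw [← h0, mul_zero])) (norm_nonneg _)
        rw [this, map_zero, map_zero, sub_zero, norm_zero]
        positivity
      · have hεn : 0 ≤ ε n := nonneg_of_mul_nonneg_left hεD h0
        refine (h2 _).trans ?_
        calc _ ≤ ε n * (C * D) := by gcongr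
          _ = _ := by ring
    -- Once `K` is linearised, the remainders are quadratic and `L` survives only through `P n ∘ L -
    -- L`.
    have hdec : T n x - T n y - L (x - y)
        = P n (K x - K y - L (x - y)) + (P n (L (x - y)) - L (x - y))
          + ((K (P n x) - K (P n y) - L (P n x - P n y))
            - P n (K (P n x) - K (P n y) - L (P n x - P n y)))
          - (P n (L (P n x - P n y)) - L (P n x - P n y)) := by
      rw [hT, hT]
      simp only [map_sub]
      abel
    have hbound : ‖T n x - T n y - L (x - y)‖ ≤ C * (Λ * (δ + δ) * D) + ε n * D
        + (Λ * ((1 + C) * δ + (1 + C) * δ) * (C * D)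
          + C * (Λ * ((1 + C) * δ + (1 + C) * δ) * (C * D))) + C * (ε n * D) := by
      rw [hdec]
      refine (norm_sub_le _ _).trans (add_le_add ?_ hL2)
      refine (norm_add_le _ _).trans (add_le_add ?_ ?_)
      · exact (norm_add_le _ _).trans (add_le_add ((hPn _).trans (by gcongr)) hL1)
      · exact (norm_sub_le _ _).trans (add_le_add hKP ((hPn _).trans (by gcongr)))
    calc _ ≤ ‖R‖ * _ := mul_le_mul_of_nonneg_left hbound (norm_nonneg _)
      _ = (Q * δ + ‖R‖ * (1 + C) * ε n) * D := by rw [hQ]; ring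
      _ ≤ (1 / 4 + 1 / 4) * D := by gcongr
      _ = _ := by ring
  refine ⟨δ, hδ0, ?_, ?_⟩
  · filter_upwards [hcontr, hress] with n h1 h2
    exact existsUnique_of_approx hR hR' hφ hδ0 h1 h2
  · filter_upwards [hcontr] with n h1 ψ hψ hψf
    exact norm_sub_le_of_approx hR hφ hδ0 h1 hψ hψf

end FixedPoint

end

noncomputable section

/-! ### The Urysohn operator near a solution -/

theorem IsDerivChain.add {m : ℕ} {X Y : ℕ → ℝ → ℝ} (hX : IsDerivChain m X)
    (hY : IsDerivChain m Y) : IsDerivChain m (fun j s => X j s + Y j s) :=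
  fun j hj s hs => (hX j hj s hs).add (hY j hj s hs)

theorem IsDerivChain.sub {m : ℕ} {X Y : ℕ → ℝ → ℝ} (hX : IsDerivChain m X)
    (hY : IsDerivChain m Y) : IsDerivChain m (fun j s => X j s - Y j s) :=
  fun j hj s hs => (hX j hj s hs).sub (hY j hj s hs)

/-- By compactness `φ` keeps a positive distance from `a` and `b`, so nearby functions stay where
the kernel is smooth. -/
theorem exists_forall_mem_Icc {φ : C(I, ℝ)} {a b : ℝ} (h : ∀ s : I, φ s ∈ Ioo a b) :
    ∃ ε : ℝ, 0 < ε ∧ ∀ x : C(I, ℝ), ‖x - φ‖ ≤ ε → ∀ t, x t ∈ Icc a b := by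
  obtain ⟨s, -, hs⟩ := isCompact_univ.exists_isMinOn (univ_nonempty (α := I))
    (f := fun s => min (φ s - a) (b - φ s)) (by fun_prop)
  refine ⟨min (φ s - a) (b - φ s), lt_min (by linarith [(h s).1]) (by linarith [(h s).2]),
    fun x hx t => ?_⟩
  have h1 := abs_le.1 (((x - φ).norm_coe_le_norm t).trans hx)
  have h2 : min (φ s - a) (b - φ s) ≤ min (φ t - a) (b - φ t) := hs (mem_univ t)
  have h3 := h2.trans (min_le_left _ _)
  have h4 := h2.trans (min_le_right _ _)
  rw [ContinuousMap.sub_apply] at h1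
  constructor <;> linarith [h1.1, h1.2]

theorem integral_unit_sub_sub {F G H : I → ℝ} (hF : Continuous F) (hG : Continuous G)
    (hH : Continuous H) :
    ∫ t : I, (F t - G t - H t) = (∫ t : I, F t) - (∫ t : I, G t) - ∫ t : I, H t := by
  have hFG : Continuous fun t => F t - G t := hF.sub hG
  rw [integral_sub (integrable_unit hFG) (integrable_unit hH),
    integral_sub (integrable_unit hF) (integrable_unit hG)]

variable {a b : ℝ} {k : ℝ → ℝ → ℝ → ℝ} {m : ℕ}

theorem continuous_iterS_comp (hab : a < b) {F : ℝ × ℝ × ℝ → ℝ} {j : ℕ}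
    (hF : ContDiffOn ℝ m F (box a b)) (hj : j ≤ m) {x : C(I, ℝ)} (hx : ∀ t, x t ∈ Icc a b) :
    Continuous (fun p : I × I => iterS a b j F ((p.1 : ℝ), (p.2 : ℝ), x p.2)) :=
  (continuousOn_iterS hab hF hj).comp_continuous
    (f := fun p : I × I => ((p.1 : ℝ), (p.2 : ℝ), x p.2)) (by fun_prop)
    fun p => ⟨p.1.2, p.2.2, hx p.2⟩

theorem continuous_iterS_slice (hab : a < b) {F : ℝ × ℝ × ℝ → ℝ} {j : ℕ}
    (hF : ContDiffOn ℝ m F (box a b)) (hj : j ≤ m) {x : C(I, ℝ)} (hx : ∀ t, x t ∈ Icc a b)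
    {s : ℝ} (hs : s ∈ Icc (0 : ℝ) 1) :
    Continuous (fun t : I => iterS a b j F (s, (t : ℝ), x t)) :=
  (continuous_iterS_comp hab hF hj hx).comp (Continuous.prodMk_right (⟨s, hs⟩ : I))

/-- The kernel `∂k/∂u (s, t, φ(t))` of the Fréchet derivative. -/
def derivKernel (hab : a < b) (hdk : KernelCm m a b (kernelDu a b k)) (φ : C(I, ℝ))
    (hφ : ∀ t, φ t ∈ Icc a b) : C(I × I, ℝ) :=
  ⟨fun p => iterS a b 0 (unc (kernelDu a b k)) ((p.1 : ℝ), (p.2 : ℝ), φ p.2),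
    continuous_iterS_comp hab hdk (Nat.zero_le m) hφ⟩

theorem exists_lipschitz_derivKernel (hab : a < b) (hdk : KernelCm (m + 1) a b (kernelDu a b k))
    {φ : C(I, ℝ)} (hφ : ∀ t, φ t ∈ Icc a b) :
    ∃ Λ : ℝ, 0 ≤ Λ ∧ ∀ s s' t : I, |derivKernel hab hdk φ hφ (s, t)
      - derivKernel hab hdk φ hφ (s', t)| ≤ Λ * |(s : ℝ) - s'| := by
  obtain ⟨Λ, hΛ, h⟩ := exists_lipschitz_iterS hab hdk (j := 0) (Nat.succ_pos m)
  refine ⟨Λ, hΛ, fun s s' t => (h _ ⟨s.2, t.2, hφ t⟩ _ ⟨s'.2, t.2, hφ t⟩).trans_eq ?_⟩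
  simp [Prod.norm_def]

/-- First-order expansion of the Urysohn operator. -/
theorem exists_urysohn_expansion (hab : a < b) (hk : IsKernel k) (hm : 1 ≤ m)
    (hks : KernelCm m a b k) (hdk : KernelCm m a b (kernelDu a b k))
    (hdk' : KernelCm (m + 1) a b (kernelDu a b k)) {φ : C(I, ℝ)} (hφ : ∀ t, φ t ∈ Icc a b) :
    ∃ Λ : ℝ, 0 ≤ Λ ∧ ∀ x y : C(I, ℝ), (∀ t, x t ∈ Icc a b) → (∀ t, y t ∈ Icc a b) →
      ‖urysohn k hk x - urysohn k hk y - kernelOp (derivKernel hab hdk' φ hφ) (x - y)‖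
        ≤ Λ * (‖x - φ‖ + ‖y - φ‖) * ‖x - y‖ := by
  obtain ⟨Λ, hΛ, h⟩ := exists_iterS_expansion hab hks hdk hdk' hm (Nat.zero_le m)
  refine ⟨Λ, hΛ, fun x y hx hy => ?_⟩
  rw [ContinuousMap.norm_le _ (by positivity)]
  intro s
  have hcx : Continuous (fun t : I => k s t (x t)) :=
    (hk.continuous_comp x).comp (Continuous.prodMk_right s)
  have hcy : Continuous (fun t : I => k s t (y t)) :=
    (hk.continuous_comp y).comp (Continuous.prodMk_right s)
  have e : (urysohn k hk x - urysohn k hk y - kernelOp (derivKernel hab hdk' φ hφ) (x - y)) s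
      = ∫ t : I, (k s t (x t) - k s t (y t)
        - derivKernel hab hdk' φ hφ (s, t) * (x - y) t) :=
    (integral_unit_sub_sub (H := fun t => derivKernel hab hdk' φ hφ (s, t) * (x - y) t)
      hcx hcy (by fun_prop)).symm
  rw [e]
  refine abs_integral_unit_le fun t => ?_
  refine (h s s.2 t t.2 (y t) (hy t) (x t) (hx t) (φ t) (hφ t)).trans ?_
  have h1 : |x t - φ t| ≤ ‖x - φ‖ := (x - φ).norm_coe_le_norm t
  have h2 : |y t - φ t| ≤ ‖y - φ‖ := (y - φ).norm_coe_le_norm t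
  have h3 : |x t - y t| ≤ ‖x - y‖ := (x - y).norm_coe_le_norm t
  gcongr

/-- A quadratic remainder has zero derivative. This identifies the integral operator with the
Fréchet derivative in the eigenvalue hypothesis. -/
theorem hasFDerivAt_of_expansion {E : Type*} [NormedAddCommGroup E] [NormedSpace ℝ E]
    {K : E → E} {L : E →L[ℝ] E} {φ : E} {Λ ε : ℝ} (hε : 0 < ε)
    (h : ∀ x, ‖x - φ‖ ≤ ε → ‖K x - K φ - L (x - φ)‖ ≤ Λ * ‖x - φ‖ * ‖x - φ‖) :
    HasFDerivAt K L φ := by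
  have h1 : (fun x => K x - K φ - L (x - φ)) =O[𝓝 φ] fun x => ‖x - φ‖ ^ 2 := by
    refine Asymptotics.IsBigO.of_bound Λ ?_
    filter_upwards [Metric.closedBall_mem_nhds φ hε] with x hx
    rw [mem_closedBall_iff_norm] at hx
    refine (h x hx).trans_eq ?_
    rw [norm_pow, norm_norm]
    ring
  have h2 : HasFDerivAt (fun x => K x - K φ - L (x - φ)) (0 : E →L[ℝ] E) φ :=
    h1.hasFDerivAt one_lt_two
  have h3 : HasFDerivAt (fun x => L (x - φ)) L φ :=
    L.hasFDerivAt.comp φ ((hasFDerivAt_id (𝕜 := ℝ) φ).sub_const φ)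
  have h4 := (h2.add h3).add_const (K φ)
  rw [zero_add] at h4
  refine h4.congr_of_eventuallyEq (Eventually.of_forall fun x => ?_)
  simp

/-! ### Regularity of the solution and the consistency error -/

/-- The successive derivatives of `K(x)`. -/
theorem isDerivChain_urysohn (hab : a < b) (hks : KernelCm m a b k) {x : C(I, ℝ)}
    (hx : ∀ t, x t ∈ Icc a b) :
    IsDerivChain m (fun j s => ∫ t : I, iterS a b j (unc k) (s, (t : ℝ), x t)) := by
  intro j hj s hs
  obtain ⟨M, hM⟩ := exists_bound_iterS hab hks (show j + 1 ≤ m from hj)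
  refine hasDerivWithinAt_integral_of_bound (M := M)
    (F := fun s (t : I) => iterS a b j (unc k) (s, (t : ℝ), x t))
    (F' := fun s (t : I) => iterS a b (j + 1) (unc k) (s, (t : ℝ), x t))
    (fun s hs => integrable_unit (continuous_iterS_slice hab hks hj.le hx hs))
    (Eventually.of_forall fun t s hs => ⟨hasDerivWithinAt_iterS hab hks hj hs t.2 (hx t),
      hM _ ⟨hs, t.2, hx t⟩⟩) hs

/-- A solution of the Urysohn equation with smooth data is smooth. -/
theorem exists_derivChain_solution (hab : a < b) (hk : IsKernel k) (hks : KernelCm m a b k)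
    {f φ : C(I, ℝ)} (hφ : φ - urysohn k hk φ = f) (hφr : ∀ t, φ t ∈ Icc a b) (hf : IsCm m f) :
    ∃ X : ℕ → ℝ → ℝ, IsDerivChain m X ∧ (∀ t : I, φ t = X 0 t) ∧
      ∀ j ≤ m, ∃ M, 0 ≤ M ∧ ∀ s ∈ Icc (0 : ℝ) 1, |X j s| ≤ M := by
  -- `φ = f + K(φ)`, and `K(φ)` is smooth whatever the smoothness of `φ`, since only the first
  -- variable of the kernel is differentiated.
  refine ⟨_, (isDerivChain_iteratedDerivWithin hf).add (isDerivChain_urysohn hab hks hφr),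
    fun t => ?_, fun j hj => ?_⟩
  · rw [iteratedDerivWithin_zero, onReal_coe]
    have := DFunLike.congr_fun hφ t
    rw [ContinuousMap.sub_apply, sub_eq_iff_eq_add] at this
    exact this
  · obtain ⟨M₁, hM₁⟩ := exists_bound_iterS hab hks hj
    have hc : ContinuousOn (iteratedDerivWithin j (onReal f) (Icc 0 1)) (Icc 0 1) :=
      ContDiffOn.continuousOn_iteratedDerivWithin hf (by exact_mod_cast hj)
        uniqueDiffOn_Icc_zero_one
    obtain ⟨M₂, hM₂⟩ := isCompact_Icc.exists_bound_of_continuousOn hc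
    have h : ∀ s ∈ Icc (0 : ℝ) 1, |iteratedDerivWithin j (onReal f) (Icc 0 1) s
        + ∫ t : I, iterS a b j (unc k) (s, (t : ℝ), φ t)| ≤ M₂ + M₁ := fun s hs =>
      (abs_add_le _ _).trans (add_le_add (hM₂ s hs)
        (abs_integral_unit_le fun t => hM₁ _ ⟨hs, t.2, hφr t⟩))
    exact ⟨M₂ + M₁, (abs_nonneg _).trans (h 0 (by simp)), h⟩

/-- The consistency error of the modified projection method. -/
theorem exists_residual_bound (hab : a < b) (hk : IsKernel k) {d : ℕ}
    (hks : KernelCm (d + 1) a b k) (hdk : KernelCm (d + 1) a b (kernelDu a b k))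
    (hdk' : KernelCm (d + 1 + 1) a b (kernelDu a b k)) {φ : C(I, ℝ)}
    (hφ : ∀ t, φ t ∈ Icc a b) :
    ∃ Λ : ℝ, 0 ≤ Λ ∧ ∀ (r n : ℕ) (σ : ℕ → ℕ → ℝ) (P : C(I, ℝ) →L[ℝ] C(I, ℝ)),
      IsQIP d r n σ P → (∀ t, P φ t ∈ Icc a b) → ∀ B : ℝ, 0 ≤ B →
      (∀ s ∈ Icc (0 : ℝ) 1, |∫ t : I, iterS a b (d + 1) (unc (kernelDu a b k)) (s, (t : ℝ), φ t)
        * (P φ - φ) t| ≤ B) →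
      ‖modifiedOp (urysohn k hk) P φ - urysohn k hk φ‖
        ≤ (‖P‖ + 1) * ((B + Λ * ‖P φ - φ‖ ^ 2) * ((d + r + 1) / n) ^ (d + 1)) := by
  obtain ⟨Λ, hΛ, hexp⟩ := exists_iterS_expansion hab hks hdk hdk' (by omega) (le_refl (d + 1))
  refine ⟨Λ, hΛ, fun r n σ P hP hPr B hB hint => ?_⟩
  set e := P φ - φ with he
  -- The order is gained twice: `P - I` acts on `K(P φ) - K(φ)`, and the derivatives of that
  -- difference are themselves small.
  have e1 : modifiedOp (urysohn k hk) P φ - urysohn k hk φ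
      = -(P (urysohn k hk (P φ) - urysohn k hk φ)
        - (urysohn k hk (P φ) - urysohn k hk φ)) := by
    rw [modifiedOp, map_sub]
    abel
  rw [e1, norm_neg]
  have hch := (isDerivChain_urysohn hab hks hPr).sub (isDerivChain_urysohn hab hks hφ)
  refine hP.error_of_derivChain (le_refl d) (hch.mono (Nat.le_succ d)) (fun t => rfl)
    (by positivity) (hch.lipschitz_of_bound fun s hs => ?_)
  have c1 : Continuous fun t : I => iterS a b (d + 1) (unc k) (s, (t : ℝ), P φ t) :=
    continuous_iterS_slice hab hks (le_refl (d + 1)) hPr hs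
  have c2 : Continuous fun t : I => iterS a b (d + 1) (unc k) (s, (t : ℝ), φ t) :=
    continuous_iterS_slice hab hks (le_refl (d + 1)) hφ hs
  have c3 : Continuous fun t : I =>
      iterS a b (d + 1) (unc (kernelDu a b k)) (s, (t : ℝ), φ t) * e t :=
    (continuous_iterS_slice hab hdk (le_refl (d + 1)) hφ hs).mul e.continuous
  -- The part linear in `e` is controlled by `B`; the rest is quadratic in `e`.
  have e2 : (∫ t : I, iterS a b (d + 1) (unc k) (s, (t : ℝ), P φ t))
      - (∫ t : I, iterS a b (d + 1) (unc k) (s, (t : ℝ), φ t))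
      = (∫ t : I, iterS a b (d + 1) (unc (kernelDu a b k)) (s, (t : ℝ), φ t) * e t)
        + ∫ t : I, (iterS a b (d + 1) (unc k) (s, (t : ℝ), P φ t)
          - iterS a b (d + 1) (unc k) (s, (t : ℝ), φ t)
          - iterS a b (d + 1) (unc (kernelDu a b k)) (s, (t : ℝ), φ t) * e t) := by
    rw [integral_unit_sub_sub c1 c2 c3]
    ring
  rw [e2]
  refine (abs_add_le _ _).trans (add_le_add (hint s hs) (abs_integral_unit_le fun t => ?_))
  refine (hexp s hs t t.2 (φ t) (hφ t) (P φ t) (hPr t) (φ t) (hφ t)).trans ?_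
  have h1 : |P φ t - φ t| ≤ ‖e‖ := e.norm_coe_le_norm t
  rw [sub_self, abs_zero, add_zero, mul_assoc, ← sq]
  gcongr

end

noncomputable section

/-! ### Order of convergence -/

/-- For even `d` and symmetric coefficients, the error of the projector is of order `d + 2` when
integrated against the kernel. -/
theorem exists_weak_error_bound {a b : ℝ} (hab : a < b) {k : ℝ → ℝ → ℝ → ℝ} {d : ℕ}
    (hd : Even d) (hdk' : KernelCm (d + 1 + 1) a b (kernelDu a b k)) {φ : C(I, ℝ)}
    (hφ : ∀ t, φ t ∈ Icc a b) {X : ℕ → ℝ → ℝ} (hX : IsDerivChain (d + 1) X)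
    (hX0 : ∀ t : I, φ t = X 0 t) {M M₁ : ℝ} (hM0 : 0 ≤ M)
    (hM : ∀ s ∈ Icc (0 : ℝ) 1, ∀ t ∈ Icc (0 : ℝ) 1, |X (d + 1) s - X (d + 1) t| ≤ M * |s - t|)
    (hM₁0 : 0 ≤ M₁) (hM₁ : ∀ s t : I, |φ s - φ t| ≤ M₁ * |(s : ℝ) - t|) (r : ℕ) {C E : ℝ}
    (hC : 0 ≤ C) (hE : 0 ≤ E) :
    ∃ A : ℝ, 0 ≤ A ∧ ∀ (n : ℕ) (σ : ℕ → ℕ → ℝ) (P : C(I, ℝ) →L[ℝ] C(I, ℝ)), 0 < n →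
      IsQIP d r n σ P → IsSymmetric d n σ → ‖P‖ ≤ C → ‖P φ - φ‖ ≤ E * (1 / n) ^ (d + 1) →
      ∀ s ∈ Icc (0 : ℝ) 1, |∫ t : I, iterS a b (d + 1) (unc (kernelDu a b k)) (s, (t : ℝ), φ t)
        * (P φ - φ) t| ≤ A * (1 / n) ^ (d + 2) := by
  obtain ⟨N, hN⟩ := exists_bound_iterS hab hdk' (show d + 1 ≤ d + 1 + 1 by omega)
  obtain ⟨Λ, hΛ, hlip⟩ := exists_lipschitz_iterS hab hdk' (show d + 1 < d + 1 + 1 by omega)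
  have hN0 : 0 ≤ N := (abs_nonneg _).trans
    (hN (0, 0, φ 0) ⟨by simp, by simp, hφ 0⟩)
  set E' : ℝ := (C + 1) * (M * (d + r + 2) ^ (d + 2)) with hE'
  have hE'0 : 0 ≤ E' := by positivity
  -- The weight is bounded by `N` and has Lipschitz constant `Λ (1 + M₁)`, as both `t` and `φ(t)`
  -- vary; `d + r` intervals are left out at each end.
  refine ⟨N * E' + Λ * (1 + M₁) * E + 2 * (d + r : ℕ) * (N * E), by positivity, ?_⟩
  intro n σ P hn hP hsym hPC hPE s hs
  have hφr : ∀ t ∈ Icc (0 : ℝ) 1, onReal φ t ∈ Icc a b := fun t ht => by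
    rw [onReal_apply _ ht]; exact hφ _
  have hswap : ∫ t : I, iterS a b (d + 1) (unc (kernelDu a b k)) (s, (t : ℝ), φ t)
      * (P φ - φ) t = ∫ t in (0 : ℝ)..1,
        iterS a b (d + 1) (unc (kernelDu a b k)) (s, t, onReal φ t) * onReal (P φ - φ) t := by
    rw [← integral_unit_eq]
    simp only [onReal_coe]
  rw [hswap]
  refine abs_integral_mul_le (D := d + r)
    (g := fun t => iterS a b (d + 1) (unc (kernelDu a b k)) (s, t, onReal φ t))
    ?_ (continuous_onReal _).continuousOn hn hE'0 ?_ ?_ ?_ ?_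
  · refine (continuousOn_iterS hab hdk' (show d + 1 ≤ d + 1 + 1 by omega)).comp
      (f := fun t : ℝ => ((s, t, onReal φ t) : ℝ × ℝ × ℝ)) ?_ fun t ht => ⟨hs, ht, hφr t ht⟩
    have := continuous_onReal φ
    fun_prop
  · exact fun t ht => hN _ ⟨hs, ht, hφr t ht⟩
  · intro t ht t' ht'
    refine (hlip _ ⟨hs, ht, hφr t ht⟩ _ ⟨hs, ht', hφr t' ht'⟩).trans ?_
    rw [mul_assoc]
    refine mul_le_mul_of_nonneg_left ?_ hΛ
    have h1 : |onReal φ t - onReal φ t'| ≤ M₁ * |t - t'| := by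
      rw [onReal_apply _ ht, onReal_apply _ ht']
      exact hM₁ _ _
    have h2 := abs_nonneg (t - t')
    have h3 : 0 ≤ M₁ * |t - t'| := by positivity
    simp only [Prod.mk_sub_mk, Prod.norm_def, sub_self, norm_zero, Real.norm_eq_abs]
    refine max_le (by positivity) (max_le ?_ ?_) <;> linarith
  · intro t ht
    rw [onReal_apply _ ht]
    exact ((P φ - φ).norm_coe_le_norm _).trans hPE
  · intro j hj1 hj2
    refine (hP.integral_error_interval hsym hd hX hX0 hM0 hM (by omega) (by omega)).trans ?_
    calc _ ≤ (C + 1) * (M * ((d + r + 2) / n) ^ (d + 2)) * (1 / n) := by gcongr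
      _ = _ := by
        rw [hE', div_eq_mul_one_div ((d : ℝ) + r + 2), mul_pow]
        ring

end

end SplineQIP

/-! ### Assembly: local solvability and the two orders of convergence -/

theorem theorem3
    (d α : ℕ) (hd : 1 ≤ d) (hα : d + 1 ≤ α)
    -- the kernel, the right-hand side and the exact solution
    (k : ℝ → ℝ → ℝ → ℝ) (hk : SplineQIP.IsKernel k)
    (f φ : C(SplineQIP.I, ℝ)) (a b : ℝ)
    (hφ_sol : φ - SplineQIP.urysohn k hk φ = f)
    (hφ_unique : ∀ x : C(SplineQIP.I, ℝ), x - SplineQIP.urysohn k hk x = f → x = φ)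
    (hφ_range : ∀ s : SplineQIP.I, φ s ∈ Set.Ioo a b)
    (hk_smooth : SplineQIP.KernelCm α a b k)
    (hdk_smooth : SplineQIP.KernelCm (2 * α) a b (SplineQIP.kernelDu a b k))
    (hf : SplineQIP.IsCm α f)
    (h_eig : ¬ Module.End.HasEigenvalue
      (fderiv ℝ (SplineQIP.urysohn k hk) φ :
        C(SplineQIP.I, ℝ) →ₗ[ℝ] C(SplineQIP.I, ℝ)) 1)
    -- a uniformly bounded sequence of spline quasi-interpolating projectors
    (r : ℕ) (σ : ℕ → ℕ → ℕ → ℝ)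
    (π : ℕ → C(SplineQIP.I, ℝ) →L[ℝ] C(SplineQIP.I, ℝ))
    (hπ : ∀ᶠ n in Filter.atTop, SplineQIP.IsQIP d r n (σ n) (π n))
    (hπ_bdd : ∃ C : ℝ, ∀ᶠ n in Filter.atTop, ‖π n‖ ≤ C) :
    ∃ δ : ℝ, 0 < δ ∧
      -- for all large `n` the approximate equation has a unique solution in the ball `B(φ, δ)`
      (∀ᶠ n in Filter.atTop, ∃! ψ : C(SplineQIP.I, ℝ),
        ψ ∈ Metric.ball φ δ ∧
          ψ - SplineQIP.modifiedOp (SplineQIP.urysohn k hk) (π n) ψ = f) ∧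
      -- and these solutions converge with the stated order
      ∀ φH : ℕ → C(SplineQIP.I, ℝ),
        (∀ᶠ n in Filter.atTop, φH n ∈ Metric.ball φ δ ∧
          φH n - SplineQIP.modifiedOp (SplineQIP.urysohn k hk) (π n) (φH n) = f) →
        (Odd d →
          (fun n : ℕ => ‖φH n - φ‖) =O[Filter.atTop]
            (fun n : ℕ => (1 / (n : ℝ)) ^ (2 * d + 2))) ∧
        (Even d →
          (∀ᶠ n in Filter.atTop, SplineQIP.IsSymmetric d n (σ n)) →
          SplineQIP.HasBoundedNextDeriv (d + 1) φ →
          (fun n : ℕ => ‖φH n - φ‖) =O[Filter.atTop]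
            (fun n : ℕ => (1 / (n : ℝ)) ^ (2 * d + 3))) := by
  have hab : a < b := (hφ_range 0).1.trans (hφ_range 0).2
  have hφr : ∀ t, φ t ∈ Icc a b := fun t => Ioo_subset_Icc_self (hφ_range t)
  have hks : KernelCm (d + 1) a b k := hk_smooth.of_le (by exact_mod_cast hα)
  have hdk' : KernelCm (d + 1 + 1) a b (kernelDu a b k) :=
    hdk_smooth.of_le (by exact_mod_cast (by omega : d + 1 + 1 ≤ 2 * α))
  have hdk : KernelCm (d + 1) a b (kernelDu a b k) :=
    hdk_smooth.of_le (by exact_mod_cast (by omega : d + 1 ≤ 2 * α))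
  have hf' : IsCm (d + 1) f := hf.of_le (by exact_mod_cast hα)
  obtain ⟨ε₀, hε₀, hrange⟩ := exists_forall_mem_Icc hφ_range
  obtain ⟨Λ, hΛ, hexp⟩ := exists_urysohn_expansion hab hk (by omega) hks hdk hdk' hφr
  set K := urysohn k hk with hKdef
  set L := kernelOp (derivKernel hab hdk' φ hφr) with hL
  have hexp' : ∀ x y, ‖x - φ‖ ≤ ε₀ → ‖y - φ‖ ≤ ε₀ →
      ‖K x - K y - L (x - y)‖ ≤ Λ * (‖x - φ‖ + ‖y - φ‖) * ‖x - y‖ :=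
    fun x y hx hy => hexp x y (hrange x hx) (hrange y hy)
  have hfd : HasFDerivAt K L φ := hasFDerivAt_of_expansion (Λ := Λ) hε₀ fun x hx => by
    simpa using hexp' x φ hx (by simpa using hε₀.le)
  rw [hfd.fderiv] at h_eig
  obtain ⟨Λ₂, hΛ₂, hLlip⟩ := exists_lipschitz_derivKernel hab hdk' hφr
  obtain ⟨R, hR, hR'⟩ := exists_inverse_of_not_hasEigenvalue
    (isCompactOperator_kernelOp hΛ₂ hLlip) h_eig
  obtain ⟨C, hC, hπC⟩ : ∃ C : ℝ, 0 ≤ C ∧ ∀ᶠ n in atTop, ‖π n‖ ≤ C := by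
    obtain ⟨C, hC⟩ := hπ_bdd
    exact ⟨max C 0, le_max_right _ _, hC.mono fun n hn => hn.trans (le_max_left _ _)⟩
  obtain ⟨X, hX, hX0, hXb⟩ := exists_derivChain_solution hab hk hks hφ_sol hφr hf'
  obtain ⟨M, hM0, hM⟩ := hXb (d + 1) le_rfl
  obtain ⟨M₁, hM₁0, hM₁⟩ := hXb 1 (by omega)
  set ρ : ℝ := d + r + 1 with hρ
  have hρ0 : 0 ≤ ρ := by positivity
  set E : ℝ := (C + 1) * (M * ρ ^ (d + 1)) with hE
  have hE0 : 0 ≤ E := by positivity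
  have hπφ : ∀ᶠ n in atTop, ‖π n φ - φ‖ ≤ E * (1 / n) ^ (d + 1) := by
    filter_upwards [hπ, hπC] with n h1 h2
    refine (h1.error_of_derivChain le_rfl (hX.mono (Nat.le_succ d)) hX0 hM0
      (hX.lipschitz_of_bound hM)).trans ?_
    calc _ ≤ (C + 1) * (M * (ρ / n) ^ (d + 1)) := by gcongr
      _ = _ := by rw [hE, div_eq_mul_one_div ρ, mul_pow]; ring
  have hpow : ∀ m : ℕ, 0 < m → Tendsto (fun n : ℕ => (1 / (n : ℝ)) ^ m) atTop (𝓝 0) :=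
    fun m hm => by simpa [hm.ne'] using (tendsto_one_div_atTop_nhds_zero_nat (𝕜 := ℝ)).pow m
  have hπφ0 : Tendsto (fun n => ‖π n φ - φ‖) atTop (𝓝 0) :=
    squeeze_zero' (Eventually.of_forall fun n => norm_nonneg _) hπφ
      (by simpa using (hpow (d + 1) (by omega)).const_mul E)
  have hπrange : ∀ᶠ n in atTop, ∀ t, π n φ t ∈ Icc a b :=
    (hπφ0.eventually_le_const hε₀).mono fun n hn => hrange _ hn
  have hπL : ∀ᶠ n in atTop, ∀ v, ‖π n (L v) - L v‖ ≤ (C + 1) * (Λ₂ * ρ) * (1 / n) * ‖v‖ := by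
    filter_upwards [hπ, hπC] with n h1 h2 v
    refine (h1.error_of_lipschitz (by positivity) (kernelOp_lipschitz hLlip v)).trans ?_
    calc _ ≤ (C + 1) * (Λ₂ * ‖v‖ * (ρ / n)) := by gcongr
      _ = _ := by ring
  obtain ⟨Λ₃, hΛ₃, hresid⟩ := exists_residual_bound hab hk hks hdk hdk' hφr
  obtain ⟨N, hN⟩ := exists_bound_iterS hab hdk (le_refl (d + 1))
  have hN0 : 0 ≤ N := (abs_nonneg _).trans (hN (0, 0, φ 0) ⟨by simp, by simp, hφr 0⟩)
  -- Here the weak error is bounded crudely by `N ‖π n φ - φ‖`: `d + 1` powers come from it and `d +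
  -- 1` from `π n - I`.
  have hres : ∀ᶠ n in atTop, ‖modifiedOp K (π n) φ - K φ‖
      ≤ (C + 1) * ((N * E + Λ₃ * (E * E)) * ρ ^ (d + 1)) * (1 / n) ^ (2 * d + 2) := by
    filter_upwards [hπ, hπC, hπφ, hπrange, eventually_gt_atTop 0] with n h1 h2 h3 h4 hn
    refine (hresid r n (σ n) (π n) h1 h4 (N * ‖π n φ - φ‖) (by positivity)
      fun s hs => abs_integral_unit_le fun t => ?_).trans ?_
    · rw [abs_mul]
      exact mul_le_mul (hN _ ⟨hs, t.2, hφr t⟩) ((π n φ - φ).norm_coe_le_norm t) (abs_nonneg _)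
        hN0
    set η : ℝ := 1 / n with hη
    have hη0 : 0 ≤ η := by positivity
    have hη1 : η ^ (d + 1) ≤ 1 := pow_le_one₀ hη0 (by
      rw [hη]; exact div_le_one_of_le₀ (by exact_mod_cast hn) (by positivity))
    have h5 : ‖π n φ - φ‖ ^ 2 ≤ E * η ^ (d + 1) * E := by
      rw [sq]
      refine mul_le_mul h3 (h3.trans (mul_le_of_le_one_right hE0 hη1)) (norm_nonneg _)
        (by positivity)
    calc _ ≤ (C + 1) * ((N * (E * η ^ (d + 1)) + Λ₃ * (E * η ^ (d + 1) * E))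
          * (ρ / n) ^ (d + 1)) := by gcongr
      _ = _ := by rw [div_eq_mul_one_div ρ, mul_pow]; ring
  obtain ⟨δ, hδ, hex, herr⟩ := exists_solution_modified hR hR' hφ_sol hΛ hε₀ hC hexp' hπC
    (ε := fun n => (C + 1) * (Λ₂ * ρ) * (1 / n))
    (by simpa using (hpow 1 one_pos).const_mul ((C + 1) * (Λ₂ * ρ))) hπL hπφ0
    (T := fun n => modifiedOp K (π n)) (fun n x => rfl)
    (squeeze_zero' (Eventually.of_forall fun n => norm_nonneg _) hres
      (by simpa using (hpow (2 * d + 2) (by omega)).const_mul _))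
  have horder : ∀ φH : ℕ → C(I, ℝ), (∀ᶠ n in atTop, φH n ∈ Metric.ball φ δ ∧
      φH n - modifiedOp K (π n) (φH n) = f) → ∀ (A : ℝ) (m : ℕ),
      (∀ᶠ n in atTop, ‖modifiedOp K (π n) φ - K φ‖ ≤ A * (1 / n) ^ m) →
      (fun n : ℕ => ‖φH n - φ‖) =O[atTop] (fun n : ℕ => (1 / (n : ℝ)) ^ m) := by
    intro φH hφH A m hA
    refine Asymptotics.IsBigO.of_bound (2 * ‖R‖ * A) ?_
    filter_upwards [hφH, herr, hA] with n h1 h2 h3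
    rw [norm_norm, Real.norm_of_nonneg (by positivity), mul_assoc]
    exact (h2 _ h1.1 h1.2).trans (by gcongr)
  refine ⟨δ, hδ, hex, fun φH hφH => ⟨fun _ => horder φH hφH _ _ hres, fun hd2 hsym hbd => ?_⟩⟩
  obtain ⟨M₂, hM₂⟩ := hbd
  have hX1 : EqOn (iteratedDerivWithin (d + 1) (onReal φ) (Icc 0 1)) (X (d + 1)) (Icc 0 1) :=
    hX.iteratedDerivWithin_eq (fun t ht => by rw [onReal_apply _ ht]; exact hX0 ⟨t, ht⟩) le_rfl
  have hXlip : ∀ s ∈ Icc (0 : ℝ) 1, ∀ t ∈ Icc (0 : ℝ) 1,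
      |X (d + 1) s - X (d + 1) t| ≤ M₂ * |s - t| := by
    intro s hs t ht
    rw [← hX1 hs, ← hX1 ht]
    exact hM₂.dist_le_mul s hs t ht
  have hφlip : ∀ s t : I, |φ s - φ t| ≤ M₁ * |(s : ℝ) - t| := fun s t => by
    rw [hX0, hX0]
    exact (hX.mono (show 0 + 1 ≤ d + 1 by omega)).lipschitz_of_bound hM₁ s s.2 t t.2
  obtain ⟨A, hA, hweak⟩ := exists_weak_error_bound hab hd2 hdk' hφr hX hX0 M₂.2 hXlip hM₁0
    hφlip r hC hE0
  refine horder φH hφH ((C + 1) * ((A + Λ₃ * (E * E)) * ρ ^ (d + 1))) _ ?_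
  filter_upwards [hπ, hπC, hπφ, hπrange, eventually_gt_atTop 0, hsym] with n h1 h2 h3 h4 hn h5
  refine (hresid r n (σ n) (π n) h1 h4 (A * (1 / n) ^ (d + 2)) (by positivity)
    (hweak n (σ n) (π n) hn h1 h5 h2 h3)).trans ?_
  set η : ℝ := 1 / n with hη
  have hη0 : 0 ≤ η := by positivity
  have hη1 : η ≤ 1 := by
    rw [hη]; exact div_le_one_of_le₀ (by exact_mod_cast hn) (by positivity)
  -- Since `2 (d + 1) ≥ d + 2`, the quadratic remainder does not spoil the extra order.
  have h6 : ‖π n φ - φ‖ ^ 2 ≤ E * E * η ^ (d + 2) := by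
    calc _ ≤ (E * η ^ (d + 1)) ^ 2 := by gcongr
      _ = E * E * η ^ (2 * (d + 1)) := by ring
      _ ≤ _ := mul_le_mul_of_nonneg_left (pow_le_pow_of_le_one hη0 hη1 (by omega))
        (by positivity)
  calc _ ≤ (C + 1) * ((A * η ^ (d + 2) + Λ₃ * (E * E * η ^ (d + 2)))
        * (ρ / n) ^ (d + 1)) := by gcongr
    _ = _ := by rw [div_eq_mul_one_div ρ, mul_pow]; ring
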